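/- Let $0<p<1$ and let $M=(M_n)_{n\ge 0}$ be a sequence of positive reals that is logarithmically convex (i.e. $n\mapsto\log M_n$ is convex), bounded away from zero, and satisfies \[ \kappa(p,M):=\limsup_{n\to\infty}\sum_{j=1}^n(1-p)^j\log M_j<+\infty . \] Functions are scalar-valued (real or complex) on $\mathbb R$. For smooth $f$ put $\|f\|_{p,M}=\sup_{k\ge0}\|f^{(k)}\|_{L^p(\mathbb R)}/M_k$. For $\theta\ge0$ let $\mathscr S_{p,\theta,M}$ be the set of $f\in C^\infty(\mathbb R)$ with $\|f\|_{p,M}<\infty$ and $\limsup_{n\to\infty}(1-p)^n\log\|f^{(n)}\|_\infty\le\theta$. Let $W^{p,\theta}_M$ be the completion of $\mathscr S_{p,\theta,M}$ in the quasinorm $\|\cdot\|_{p,M}$, regarded as a subset of $L^p\times L^p\times\cdots$ through the extension of $f\mapsto(f,f',f'',\dots)$; that is, $W^{p,\theta}_M$ consists of the coordinatewise $L^p$-limits $(f_0,f_1,\dots)$ of sequences in $\mathscr S_{p,\theta,M}$ that are Cauchy in $\|\cdot\|_{p,M}$. The $L^p$-Carleman class $\mathcal C^{p,\theta}_M$ consists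 of all dilates $\big(a^nf_n(a\,\cdot)\big)_{n\ge0}$, $a>0$, of elements $(f_n)_{n\ge0}$ of $W^{p,\theta}_M$. For a positive sequence $N$, the classical Carleman class $\mathcal C_N$ consists of the $f\in C^\infty(\mathbb R)$ for which there are constants $C,A>0$ with $\|f^{(k)}\|_\infty\le CA^kN_k$ for all $k\ge 0$. A class is called quasianalytic if each of its elements is determined, within the class, by the values at any single point of all its derivatives (for $\mathcal C^{p,\theta}_M$: of the continuous representatives of all the components $f_n$). The sequence $M$ is called decay-regular if there is $\epsilon>0$ with $M_n/M_{n+1}\ge\epsilon^n$ for all $n\ge1$, or if $\sum_{n\ge1}M_n/M_{n+1}<\infty$. Then the following hold. (i) If $\theta>0$, then $\mathcal C^{p,\theta}_M$ is not quasianalytic. (ii) If $M$ is decay-regular, then $\mathcal C^{p,0}_M$ is quasianalytic if and only if the classical Carleman class $\mathcal C_N$ is quasianalytic, where \[ N_n=\prod_{j=1}^{\infty}M_{n+j}^{\,p(1-p)^{j-1}},\qquad n=0,1,2,\dots \] -/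

import Mathlib

open MeasureTheory Filter Topology
open scoped ENNReal ContDiff

noncomputable section

namespace LpCarleman

/-- Log-convexity of a sequence of positive reals: `j ↦ log (M j)` is convex. -/
def IsLogConvex (M : ℕ → ℝ) : Prop :=
  ∀ n, 2 * Real.log (M (n + 1)) ≤ Real.log (M n) + Real.log (M (n + 2))

/-- The `p`-characteristic
`κ(p, M) = limsup_{n → ∞} ∑_{j=1}^n (1-p)^j log M_j`, an extended real number. -/
def pCharacteristic (p : ℝ) (M : ℕ → ℝ) : EReal :=
  limsup (fun n : ℕ =>
    ((∑ j ∈ Finset.Icc 1 n, (1 - p) ^ j * Real.log (M j) : ℝ) : EReal)) atTop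

/-- Decay-regularity (of a log-convex sequence with finite `p`-characteristic):
`M_n / M_{n+1} ≥ ε^n` for all `n ≥ 1` and some `ε > 0`, or `∑_{n ≥ 1} M_n / M_{n+1} < ∞`. -/
def IsDecayRegular (M : ℕ → ℝ) : Prop :=
  (∃ ε : ℝ, 0 < ε ∧ ∀ n : ℕ, 1 ≤ n → ε ^ n ≤ M n / M (n + 1)) ∨
    Summable (fun n : ℕ => M (n + 1) / M (n + 2))

/-- The associated sequence `N_n = ∏_{j ≥ 1} M_{n+j}^{p (1-p)^{j-1}}`
(the product index is shifted by one). -/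
def associatedWeight (p : ℝ) (M : ℕ → ℝ) (n : ℕ) : ℝ :=
  ∏' j : ℕ, M (n + (j + 1)) ^ (p * (1 - p) ^ j)

section Classes

variable {𝕜 : Type*} [RCLike 𝕜]

/-- The quasinorm `‖f‖_{p,M} = sup_k ‖f^{(k)}‖_p / M_k` of a smooth function. -/
def quasinorm (p : ℝ) (M : ℕ → ℝ) (f : ℝ → 𝕜) : ℝ≥0∞ :=
  ⨆ k : ℕ, eLpNorm (iteratedDeriv k f) (ENNReal.ofReal p) volume / ENNReal.ofReal (M k)

variable (𝕜)

/-- The maximal class of test functions: smooth `f` with `‖f‖_{p,M} < ∞` and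
`limsup_n (1-p)^n log ‖f^{(n)}‖_∞ ≤ θ` (with `log 0 = -∞`, `log ∞ = +∞`). -/
def testClass (p θ : ℝ) (M : ℕ → ℝ) : Set (ℝ → 𝕜) :=
  {f | ContDiff ℝ ∞ f ∧ quasinorm p M f < ⊤ ∧
    limsup (fun n : ℕ => (((1 - p) ^ n : ℝ) : EReal) *
      ENNReal.log (eLpNorm (iteratedDeriv n f) ∞ volume)) atTop ≤ (θ : EReal)}

/-- Elements of the Cartesian product `L^p × L^p × ⋯`. -/
abbrev LpSeq (p : ℝ) : Type _ := ℕ → Lp 𝕜 (ENNReal.ofReal p) (volume : Measure ℝ)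

/-- The `L^p`-Carleman space: the completion of the test class in the quasinorm `‖·‖_{p,M}`,
realised in `L^p × L^p × ⋯` through the isometric extension of `f ↦ (f, f', f'', …)`.
Its elements are the coordinatewise `L^p`-limits of the sequences of test functions that are
Cauchy in `‖·‖_{p,M}`. -/
def carlemanSpace (p θ : ℝ) (M : ℕ → ℝ) : Set (LpSeq 𝕜 p) :=
  {F | ∃ f : ℕ → ℝ → 𝕜, (∀ j, f j ∈ testClass 𝕜 p θ M) ∧
    (∀ ε : ℝ≥0∞, 0 < ε → ∃ J : ℕ, ∀ i ≥ J, ∀ j ≥ J, quasinorm p M (f i - f j) ≤ ε) ∧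
    ∀ n : ℕ, Tendsto
      (fun j => eLpNorm (fun x => iteratedDeriv n (f j) x - F n x) (ENNReal.ofReal p) volume)
      atTop (𝓝 0)}

/-- The `L^p`-Carleman class: all dilates `f_a(t) = f(a t)`, `a > 0`, of elements `f` of the
`L^p`-Carleman space. On `L^p × L^p × ⋯`, where the `n`-th component stands for the `n`-th
derivative, the dilation acts by `(f_n) ↦ (a^n f_n(a ·))`. -/
def lpCarlemanClass (p θ : ℝ) (M : ℕ → ℝ) : Set (LpSeq 𝕜 p) :=
  {G | ∃ F ∈ carlemanSpace 𝕜 p θ M, ∃ a : ℝ, 0 < a ∧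
    ∀ n : ℕ, (G n : ℝ → 𝕜) =ᵐ[volume] fun x => (a ^ n : ℝ) • (F n : ℝ → 𝕜) (a * x)}

/-- The classical Carleman class: smooth `f` on `ℝ` with `‖f^{(k)}‖_∞ ≤ C A^k M_k` for some
positive constants `C`, `A` depending on `f`. -/
def carlemanClass (M : ℕ → ℝ) : Set (ℝ → 𝕜) :=
  {f | ContDiff ℝ ∞ f ∧ ∃ C A : ℝ, 0 < C ∧ 0 < A ∧
    ∀ k : ℕ, eLpNorm (iteratedDeriv k f) ∞ volume ≤ ENNReal.ofReal (C * A ^ k * M k)}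

variable {𝕜}

/-- A class of smooth functions is quasianalytic if the formal Taylor series at any given point
determines the function. -/
def IsQuasianalytic (S : Set (ℝ → 𝕜)) : Prop :=
  ∀ f ∈ S, ∀ g ∈ S, ∀ a : ℝ,
    (∀ n : ℕ, iteratedDeriv n f a = iteratedDeriv n g a) → f = g

/-- `f` lists the continuous representatives of the components of `F`. Such representatives are
unique, so that `f n a` is the value at the point `a` of the `n`-th derivative of the element
`F`. -/
def IsContinuousRep {p : ℝ} (F : LpSeq 𝕜 p) (f : ℕ → ℝ → 𝕜) : Prop :=
  ∀ n : ℕ, Continuous (f n) ∧ (F n : ℝ → 𝕜) =ᵐ[volume] f n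

/-- Quasianalyticity for a class of elements of `L^p × L^p × ⋯`: an element is determined within
the class by the values of all its derivatives (its formal Taylor series) at any given point.
The values are those of the continuous representatives. -/
def IsQuasianalyticLp {p : ℝ} (S : Set (LpSeq 𝕜 p)) : Prop :=
  ∀ F ∈ S, ∀ G ∈ S, ∀ f g : ℕ → ℝ → 𝕜, IsContinuousRep F f → IsContinuousRep G g →
    ∀ a : ℝ, (∀ n : ℕ, f n a = g n a) → F = G

end Classes

end LpCarleman

end

/-! Sufficiency in (ii) rests on one inequality: `‖f‖_∞ ≤ ∫ |f'| ≤ ‖f'‖_p ^ p * ‖f'‖_∞ ^ (1 - p)`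
(`eLpNorm_top_le_deriv`). Iterating it `m` times bounds `‖f^(n)‖_∞` by a partial product of the
`‖f^(n+j)‖_p ^ (p (1-p)^(j-1))` times `‖f^(n+m)‖_∞ ^ ((1-p)^m)`. For `θ = 0` the limiting
contribution of the last factor is at most 1, so `‖f^(n)‖_∞ ≤ ‖f‖_{p,M} N_n`
(`eLpNorm_top_iteratedDeriv_le`). Cauchy sequences in the quasinorm therefore converge uniformly
with all derivatives, and every element of the class is the jet of a function in `C_N`.

Failure of quasianalyticity is always shown by a nonzero test function that is flat at a point. One
source is an infinite convolution of box kernels of summable widths (`exists_iterated_convolution`):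
its derivatives are large, but the `n`-th lives on a set whose measure is governed by the tail of
the widths, and for `p < 1` a small carrier can pay for a large sup norm. With doubly exponentially
small widths this gives (i); with widths proportional to `M_{n-1}/M_n` it shows that `C^{p,0}_M` is
not quasianalytic when these ratios are summable.

The other source serves the case `M_n / M_{n+1} ≥ ε^n`. There `N_n ≤ C A^n M_n`, so `C_N` lies in
`C_M`. A nonzero flat function in `C_M` can be made compactly supported by cutting off and
reflecting, and on a bounded support sup bounds are `L^p` bounds. -/

namespace LpCarleman

/-! ### Infinite convolutions of box kernels. -/

section BoxAverages

/-- The average of `g` over the interval `[x - a, x]`. -/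
noncomputable def boxAverage (a : ℝ) (g : ℝ → ℝ) (x : ℝ) : ℝ :=
  ∫ t in (0 : ℝ)..1, g (x - a * t)

/-- The ramp `max x 0` averaged successively over boxes of widths `a n, …, a (n + m - 1)`. -/
noncomputable def iteratedBox (a : ℕ → ℝ) : ℕ → ℕ → ℝ → ℝ
  | 0, _ => fun x => max x 0
  | m + 1, n => boxAverage (a n) (iteratedBox a m (n + 1))

lemma intervalIntegrable_comp_sub_mul {g : ℝ → ℝ} (hg : Continuous g) (a x : ℝ) :
    IntervalIntegrable (fun t => g (x - a * t)) volume 0 1 :=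
  (by fun_prop : Continuous fun t => g (x - a * t)).intervalIntegrable _ _

lemma abs_boxAverage_sub_le {g h : ℝ → ℝ} (hg : Continuous g) (hh : Continuous h)
    {C a x y : ℝ} (hC : ∀ t ∈ Set.Icc (0 : ℝ) 1, |g (x - a * t) - h (y - a * t)| ≤ C) :
    |boxAverage a g x - boxAverage a h y| ≤ C := by
  unfold boxAverage
  rw [← intervalIntegral.integral_sub (intervalIntegrable_comp_sub_mul hg a x)
    (intervalIntegrable_comp_sub_mul hh a y)]
  have := intervalIntegral.norm_integral_le_of_norm_le_const (a := (0 : ℝ)) (b := 1) (C := C)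
    (f := fun t => g (x - a * t) - h (y - a * t)) (fun t ht => by
      rw [Set.uIoc_of_le zero_le_one] at ht
      exact hC t ⟨ht.1.le, ht.2⟩)
  simpa using this

lemma lipschitzWith_boxAverage {g : ℝ → ℝ} (hg : LipschitzWith 1 g) (a : ℝ) :
    LipschitzWith 1 (boxAverage a g) := by
  refine LipschitzWith.of_dist_le_mul fun x y => ?_
  rw [Real.dist_eq]
  refine abs_boxAverage_sub_le hg.continuous hg.continuous fun t _ => ?_
  simpa [Real.dist_eq] using hg.dist_le_mul (x - a * t) (y - a * t)

lemma abs_boxAverage_sub_self_le {g : ℝ → ℝ} (hg : LipschitzWith 1 g) {a : ℝ} (ha : 0 ≤ a)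
    (x : ℝ) : |boxAverage a g x - g x| ≤ a := by
  have h : g x = boxAverage 0 g x := by simp [boxAverage]
  have h2 : ∫ t in (0 : ℝ)..1, (g (x - a * t) - g x) = boxAverage a g x - g x := by
    rw [intervalIntegral.integral_sub (intervalIntegrable_comp_sub_mul hg.continuous a x)
      (by simp)]
    simp [boxAverage]
  rw [← h2]
  have := intervalIntegral.norm_integral_le_of_norm_le_const (a := (0 : ℝ)) (b := 1) (C := a)
    (f := fun t => g (x - a * t) - g x) (fun t ht => by
      rw [Set.uIoc_of_le zero_le_one] at ht
      have := hg.dist_le_mul (x - a * t) x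
      rw [Real.dist_eq, Real.dist_eq] at this
      simp only [NNReal.coe_one, one_mul, sub_sub_cancel_left, abs_neg] at this
      rw [abs_of_nonneg (mul_nonneg ha ht.1.le)] at this
      exact this.trans (mul_le_of_le_one_right ha ht.2))
  simpa using this

lemma lipschitzWith_iteratedBox (a : ℕ → ℝ) (m n : ℕ) : LipschitzWith 1 (iteratedBox a m n) := by
  induction m generalizing n with
  | zero => exact LipschitzWith.id.max_const 0
  | succ m ih => exact lipschitzWith_boxAverage (ih _) _

lemma iteratedBox_of_nonpos {a : ℕ → ℝ} (ha : ∀ n, 0 ≤ a n) (m n : ℕ) {x : ℝ} (hx : x ≤ 0) :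
    iteratedBox a m n x = 0 := by
  induction m generalizing n x with
  | zero => simpa [iteratedBox] using hx
  | succ m ih =>
    simp only [iteratedBox, boxAverage]
    rw [intervalIntegral.integral_congr (g := fun _ => (0 : ℝ))]
    · simp
    · intro t ht
      rw [Set.uIcc_of_le zero_le_one] at ht
      exact ih _ (by nlinarith [ha n, ht.1])

/-- Averaging an affine function of slope one over a box of width `a` lowers it by `a / 2`; to the
right of the total width only the affine part of the ramp is seen. -/
lemma iteratedBox_of_le {a : ℕ → ℝ} (ha : ∀ n, 0 ≤ a n) (m n : ℕ) {x : ℝ}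
    (hx : ∑ k ∈ Finset.range m, a (n + k) ≤ x) :
    iteratedBox a m n x = x - (∑ k ∈ Finset.range m, a (n + k)) / 2 := by
  induction m generalizing n x with
  | zero => simpa [iteratedBox] using hx
  | succ m ih =>
    have hs : ∑ k ∈ Finset.range (m + 1), a (n + k)
        = a n + ∑ k ∈ Finset.range m, a (n + 1 + k) := by
      rw [Finset.sum_range_succ', add_comm]
      simp [add_assoc, add_comm 1]
    rw [hs] at hx ⊢
    simp only [iteratedBox, boxAverage]
    rw [intervalIntegral.integral_congr
      (g := fun t => (x - (∑ k ∈ Finset.range m, a (n + 1 + k)) / 2) - a n * t)]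
    · rw [intervalIntegral.integral_sub (by simp)
        ((by fun_prop : Continuous fun t : ℝ => a n * t).intervalIntegrable _ _)]
      rw [intervalIntegral.integral_const_mul, integral_id, intervalIntegral.integral_const]
      simp only [smul_eq_mul]
      ring
    · intro t ht
      rw [Set.uIcc_of_le zero_le_one] at ht
      dsimp only
      rw [ih _ (by nlinarith [ha n, ht.2])]
      ring

/-- The two sides differ only by one extra average at the innermost level, which moves a 1-Lipschitz
function by at most the box width. The outer averages are contractions for the sup norm. -/
lemma abs_iteratedBox_succ_sub_le {a : ℕ → ℝ} (ha : ∀ n, 0 ≤ a n) (m n : ℕ) (x : ℝ) :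
    |iteratedBox a (m + 1) n x - iteratedBox a m n x| ≤ a (n + m) := by
  induction m generalizing n x with
  | zero =>
    exact abs_boxAverage_sub_self_le (lipschitzWith_iteratedBox a 0 (n + 1)) (ha n) x
  | succ m ih =>
    refine abs_boxAverage_sub_le (lipschitzWith_iteratedBox a _ _).continuous
      (lipschitzWith_iteratedBox a _ _).continuous fun t _ => ?_
    simpa [add_assoc, add_comm 1] using ih (n + 1) (x - a n * t)

/-- The limit of the iterated box averages: a self-similar family of smooth ramps. -/
theorem exists_smooth_ramps {a : ℕ → ℝ} (ha : ∀ n, 0 < a n) (hs : Summable a) :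
    ∃ G : ℕ → ℝ → ℝ, (∀ n, LipschitzWith 1 (G n)) ∧ (∀ n, ∀ x ≤ 0, G n x = 0) ∧
      (∀ n x, ∑' k, a (n + k) ≤ x → G n x = x - (∑' k, a (n + k)) / 2) ∧
      ∀ n x, G n x = boxAverage (a n) (G (n + 1)) x := by
  have ha' : ∀ n, 0 ≤ a n := fun n => (ha n).le
  have hsn : ∀ n, Summable fun k => a (n + k) := fun n => by
    simpa [add_comm] using (summable_nat_add_iff n).2 hs
  have hlim : ∀ n x, ∃ y, Tendsto (fun m => iteratedBox a m n x) atTop (𝓝 y) := fun n x =>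
    cauchySeq_tendsto_of_complete <| cauchySeq_of_dist_le_of_summable _ (fun m => by
      rw [dist_comm, Real.dist_eq]
      exact abs_iteratedBox_succ_sub_le ha' m n x) (hsn n)
  choose G hG using hlim
  have hL : ∀ n, LipschitzWith 1 (G n) := fun n => LipschitzWith.of_dist_le_mul fun x y =>
    le_of_tendsto ((hG n x).dist (hG n y)) (Eventually.of_forall fun m =>
      (lipschitzWith_iteratedBox a m n).dist_le_mul x y)
  refine ⟨G, hL, ?_, ?_, ?_⟩
  · intro n x hx
    refine tendsto_nhds_unique (hG n x) ?_
    simp [iteratedBox_of_nonpos ha' _ n hx]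
  · intro n x hx
    refine tendsto_nhds_unique (hG n x) ?_
    have h1 : Tendsto (fun m => x - (∑ k ∈ Finset.range m, a (n + k)) / 2) atTop
        (𝓝 (x - (∑' k, a (n + k)) / 2)) :=
      tendsto_const_nhds.sub ((hsn n).hasSum.tendsto_sum_nat.div_const 2)
    refine h1.congr fun m => (iteratedBox_of_le ha' m n ?_).symm
    exact ((hsn n).sum_le_tsum _ fun k _ => ha' _).trans hx
  · intro n x
    refine tendsto_nhds_unique ((hG n x).comp (tendsto_add_atTop_nat 1)) ?_
    have h0 : ∀ m y, |iteratedBox a m (n + 1) y| ≤ |y| := fun m y => by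
      have := (lipschitzWith_iteratedBox a m (n + 1)).dist_le_mul y 0
      simpa [Real.dist_eq, iteratedBox_of_nonpos ha' m (n + 1) le_rfl] using this
    refine intervalIntegral.tendsto_integral_filter_of_dominated_convergence
      (fun t => |x - a n * t|) ?_ ?_ ?_ ?_
    · refine Eventually.of_forall fun m => Continuous.aestronglyMeasurable ?_
      have := (lipschitzWith_iteratedBox a m (n + 1)).continuous
      fun_prop
    · exact Eventually.of_forall fun m => ae_of_all _ fun t _ => h0 m _
    · exact (by fun_prop : Continuous fun t => |x - a n * t|).intervalIntegrable _ _
    · exact ae_of_all _ fun t _ => hG (n + 1) _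

lemma hasDerivAt_boxAverage {g : ℝ → ℝ} (hg : Continuous g) {a : ℝ} (ha : a ≠ 0) (x : ℝ) :
    HasDerivAt (boxAverage a g) ((g x - g (x - a)) / a) x := by
  have h : boxAverage a g = fun x =>
      a⁻¹ * ((∫ t in (0 : ℝ)..x, g t) - ∫ t in (0 : ℝ)..(x - a), g t) := by
    ext y
    rw [boxAverage, intervalIntegral.integral_comp_sub_mul (fun t => g t) ha,
      intervalIntegral.integral_interval_sub_left (hg.intervalIntegrable _ _)
        (hg.intervalIntegrable _ _)]
    simp
  rw [h]
  have h1 : ∀ y, HasDerivAt (fun x => ∫ t in (0 : ℝ)..x, g t) (g y) y := fun y =>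
    intervalIntegral.integral_hasDerivAt_right (hg.intervalIntegrable _ _)
      (hg.stronglyMeasurableAtFilter _ _) hg.continuousAt
  have h2 : HasDerivAt (fun x => ∫ t in (0 : ℝ)..(x - a), g t) (g (x - a)) x := by
    simpa using (h1 (x - a)).comp_sub_const x a
  exact (((h1 x).sub h2).const_mul a⁻¹).congr_deriv (inv_mul_eq_div _ _)

/-- For every summable positive sequence `a` there is a nonzero smooth function whose `n`-th
derivative is at most `2 ^ (n + 1) / (a 0 ⋯ a n)` and lives on a set of measure at most
`2 ^ n ∑_{k ≥ n} a k`. -/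
theorem exists_iterated_convolution {a : ℕ → ℝ} (ha : ∀ n, 0 < a n) (hs : Summable a) :
    ∃ f : ℝ → ℝ, ContDiff ℝ ∞ f ∧ f ≠ 0 ∧ (∀ n, iteratedDeriv n f (-1) = 0) ∧
      (∀ n x, |iteratedDeriv n f x| ≤ 2 ^ (n + 1) / ∏ i ∈ Finset.range (n + 1), a i) ∧
      ∀ n, ∃ S : Set ℝ, MeasurableSet S ∧ volume S ≤ ENNReal.ofReal (2 ^ n * ∑' k, a (n + k)) ∧
        ∀ x ∉ S, iteratedDeriv n f x = 0 := by
  obtain ⟨G, hL, hG0, hGt, hG⟩ := exists_smooth_ramps ha hs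
  have hd : ∀ n, deriv (G n) = fun x => (G (n + 1) x - G (n + 1) (x - a n)) / a n := fun n => by
    ext x
    rw [funext (hG n)]
    exact (hasDerivAt_boxAverage (hL (n + 1)).continuous (ha n).ne' x).deriv
  have hdiff : ∀ n, Differentiable ℝ (G n) := fun n x => by
    rw [funext (hG n)]
    exact (hasDerivAt_boxAverage (hL (n + 1)).continuous (ha n).ne' x).differentiableAt
  -- The derivative of `G n` is a difference quotient of `G (n + 1)`, so smoothness is gained for
  -- all `n` at once.
  have hck : ∀ k : ℕ, ∀ n, ContDiff ℝ k (G n) := by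
    intro k
    induction k with
    | zero => exact fun n => contDiff_zero.2 (hL n).continuous
    | succ k ih =>
      intro n
      push_cast
      rw [contDiff_succ_iff_deriv]
      refine ⟨hdiff n, by simp, ?_⟩
      rw [hd n]
      exact ((ih (n + 1)).sub ((ih (n + 1)).comp (contDiff_id.sub contDiff_const))).div_const _
  have hc : ∀ n, ContDiff ℝ ∞ (G n) := fun n => contDiff_infty.2 fun k => hck k n
  have hrec : ∀ k n x, iteratedDeriv (k + 1) (G n) x
      = (iteratedDeriv k (G (n + 1)) x - iteratedDeriv k (G (n + 1)) (x - a n)) / a n := by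
    intro k n x
    have e : deriv (G n) = (a n)⁻¹ • (G (n + 1) - fun x => G (n + 1) (x - a n)) := by
      rw [hd n]
      ext y
      simp [div_eq_inv_mul]
    have h2 : ContDiff ℝ k (fun x => G (n + 1) (x - a n)) :=
      (hck k (n + 1)).comp (contDiff_id.sub contDiff_const)
    rw [iteratedDeriv_succ', e, iteratedDeriv_const_smul_field,
      iteratedDeriv_sub (hck k _).contDiffAt h2.contDiffAt, iteratedDeriv_comp_sub_const]
    simp [div_eq_inv_mul]
  have hbd : ∀ k n x, |iteratedDeriv (k + 2) (G n) x|
      ≤ 2 ^ (k + 1) / ∏ i ∈ Finset.range (k + 1), a (n + i) := by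
    intro k
    induction k with
    | zero =>
      intro n x
      rw [hrec]
      simp only [zero_add, pow_one, Finset.prod_range_one, add_zero, iteratedDeriv_one]
      rw [abs_div, abs_of_pos (ha n)]
      have h1 : ∀ y, |deriv (G (n + 1)) y| ≤ 1 := fun y => by
        simpa using norm_deriv_le_of_lipschitz (hL (n + 1)) (x₀ := y)
      have := (abs_sub (deriv (G (n + 1)) x) (deriv (G (n + 1)) (x - a n))).trans
        (add_le_add (h1 _) (h1 _))
      have := ha n
      gcongr
      linarith
    | succ k ih =>
      intro n x
      rw [show k + 1 + 2 = (k + 2) + 1 by ring, hrec, abs_div, abs_of_pos (ha n)]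
      have h2 := (abs_sub (iteratedDeriv (k + 2) (G (n + 1)) x)
        (iteratedDeriv (k + 2) (G (n + 1)) (x - a n))).trans
        (add_le_add (ih (n + 1) x) (ih (n + 1) (x - a n)))
      have h3 : ∏ i ∈ Finset.range (k + 1 + 1), a (n + i)
          = (∏ i ∈ Finset.range (k + 1), a (n + 1 + i)) * a n := by
        rw [Finset.prod_range_succ']
        simp [add_assoc, add_comm 1]
      rw [h3, ← div_div]
      have := (ha n).le
      gcongr
      refine h2.trans (le_of_eq ?_)
      ring
  -- `G n` is affine on each side of an interval as long as the tail of the widths, so its second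
  -- derivative lives there. Each further derivative is a difference of two translates and doubles
  -- the measure.
  have hsupp : ∀ k n, ∃ S : Set ℝ, MeasurableSet S ∧
      volume S ≤ ENNReal.ofReal (2 ^ k * ∑' j, a (n + k + j)) ∧
      ∀ x ∉ S, iteratedDeriv (k + 2) (G n) x = 0 := by
    intro k
    induction k with
    | zero =>
      intro n
      refine ⟨Set.Icc 0 (∑' j, a (n + j)), measurableSet_Icc, by simp, fun x hx => ?_⟩
      rw [zero_add, iteratedDeriv_succ', iteratedDeriv_one]
      have hcases : x < 0 ∨ ∑' j, a (n + j) < x := by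
        by_contra! h
        exact hx h
      rcases hcases with h | h
      · have h1 : G n =ᶠ[𝓝 x] fun _ => 0 := by
          filter_upwards [Iio_mem_nhds h] with y hy using hG0 n y (le_of_lt hy)
        have h2 : deriv (G n) =ᶠ[𝓝 x] fun _ => 0 := by simpa using h1.deriv
        rw [h2.deriv_eq]
        simp
      · have h1 : G n =ᶠ[𝓝 x] fun y => y - (∑' j, a (n + j)) / 2 := by
          filter_upwards [Ioi_mem_nhds h] with y hy using hGt n y (le_of_lt hy)
        have h2 : deriv (G n) =ᶠ[𝓝 x] fun _ => 1 := by
          refine h1.deriv.trans (Eventually.of_forall fun y => ?_)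
          simp
        rw [h2.deriv_eq]
        simp
    | succ k ih =>
      intro n
      obtain ⟨S, hS, hv, hz⟩ := ih (n + 1)
      refine ⟨S ∪ (fun x => x - a n) ⁻¹' S, hS.union (measurable_sub_const _ hS), ?_, ?_⟩
      · refine (measure_union_le _ _).trans ?_
        have : volume ((fun x => x - a n) ⁻¹' S) = volume S := by
          simp [sub_eq_add_neg]
        rw [this, ← two_mul]
        refine (mul_le_mul_right hv 2).trans (le_of_eq ?_)
        rw [← ENNReal.ofReal_ofNat 2, ← ENNReal.ofReal_mul (by norm_num), pow_succ']
        congr 1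
        rw [mul_assoc, show n + (k + 1) = n + 1 + k by ring]
      · intro x hx
        rw [Set.mem_union, not_or] at hx
        rw [show k + 1 + 2 = (k + 2) + 1 by ring, hrec, hz x hx.1, hz _ hx.2]
        simp
  have hit : ∀ k, iteratedDeriv k (deriv (deriv (G 0))) = iteratedDeriv (k + 2) (G 0) :=
    fun k => by rw [iteratedDeriv_succ', iteratedDeriv_succ']
  -- The second derivative of the limiting ramp is the infinite convolution of the normalized boxes.
  refine ⟨deriv (deriv (G 0)), ?_, ?_, ?_, ?_, ?_⟩
  · have h1 := (contDiff_infty_iff_deriv.1 (hc 0)).2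
    exact (contDiff_infty_iff_deriv.1 h1).2
  · intro h
    have h1 : ∀ x, deriv (G 0) x = 0 := by
      intro x
      have hd1 : Differentiable ℝ (deriv (G 0)) :=
        (contDiff_infty_iff_deriv.1 (contDiff_infty_iff_deriv.1 (hc 0)).2).1
      rw [is_const_of_deriv_eq_zero hd1 (fun y => congrFun h y) x (-1)]
      have : G 0 =ᶠ[𝓝 (-1)] fun _ => 0 := by
        filter_upwards [Iio_mem_nhds (show (-1 : ℝ) < 0 by norm_num)] with y hy
          using hG0 0 y (le_of_lt hy)
      rw [this.deriv_eq]
      simp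
    have h2 := is_const_of_deriv_eq_zero (hdiff 0) h1 (∑' k, a (0 + k)) 0
    rw [hGt 0 _ le_rfl, hG0 0 _ le_rfl] at h2
    have h3 : 0 < ∑' k, a (0 + k) := by
      simpa using hs.tsum_pos (fun i => (ha i).le) 0 (ha 0)
    linarith
  · intro n
    rw [hit]
    have : G 0 =ᶠ[𝓝 (-1)] fun _ => 0 := by
      filter_upwards [Iio_mem_nhds (show (-1 : ℝ) < 0 by norm_num)] with y hy
        using hG0 0 y (le_of_lt hy)
    rw [this.iteratedDeriv_eq]
    simp
  · intro n x
    rw [hit]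
    simpa only [zero_add] using hbd n 0 x
  · intro n
    rw [hit]
    simpa only [zero_add] using hsupp n 0

end BoxAverages

/-! ### Test functions that defeat quasianalyticity, and statement (i). -/

section TestFunctions

variable {𝕜 : Type*} [RCLike 𝕜]

lemma norm_iteratedDeriv_ofReal {f : ℝ → ℝ} (hf : ContDiff ℝ ∞ f) (n : ℕ) (x : ℝ) :
    ‖iteratedDeriv n (fun x => (f x : 𝕜)) x‖ = |iteratedDeriv n f x| := by
  have h := (RCLike.ofRealLI (K := 𝕜)).norm_iteratedFDeriv_comp_left (x := x) (i := n)
    hf.contDiffAt (by exact_mod_cast le_top)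
  rw [norm_iteratedFDeriv_eq_norm_iteratedDeriv, norm_iteratedFDeriv_eq_norm_iteratedDeriv] at h
  exact h

/-- A criterion for membership in the test class in terms of sup-norm bounds `B n` and the
measures `V n` of sets that carry the derivatives. -/
lemma mem_testClass_of_bounds {p θ c : ℝ} (hp0 : 0 < p) (hp1 : p < 1) {M : ℕ → ℝ}
    (hM : ∀ n, 0 < M n) {f : ℝ → 𝕜} (hf : ContDiff ℝ ∞ f) {B V : ℕ → ℝ}
    (hB : ∀ n, 0 < B n) (hV : ∀ n, 0 ≤ V n) (hfB : ∀ n x, ‖iteratedDeriv n f x‖ ≤ B n)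
    (hS : ∀ n, ∃ S : Set ℝ, MeasurableSet S ∧ volume S ≤ ENNReal.ofReal (V n) ∧
      ∀ x ∉ S, iteratedDeriv n f x = 0)
    (hc : ∀ n, V n ^ p⁻¹ * B n ≤ c * M n)
    (hlim : Tendsto (fun n => (1 - p) ^ n * Real.log (B n)) atTop (𝓝 θ)) :
    f ∈ testClass 𝕜 p θ M := by
  refine ⟨hf, ?_, ?_⟩
  · refine lt_of_le_of_lt (iSup_le fun k => ?_) (ENNReal.ofReal_lt_top (r := c))
    rw [ENNReal.div_le_iff (by simpa using hM k) ENNReal.ofReal_ne_top,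
      ← ENNReal.ofReal_mul' (hM k).le]
    refine le_trans ?_ (ENNReal.ofReal_le_ofReal (hc k))
    obtain ⟨S, -, hSv, hS0⟩ := hS k
    rw [← eLpNorm_restrict_eq_of_support_subset (s := S)
      (Function.support_subset_iff'.2 hS0)]
    refine (eLpNorm_le_of_ae_bound (ae_of_all _ (hfB k))).trans ?_
    rw [Measure.restrict_apply_univ, ENNReal.toReal_ofReal hp0.le,
      ENNReal.ofReal_mul (Real.rpow_nonneg (hV k) _),
      ← ENNReal.ofReal_rpow_of_nonneg (hV k) (inv_nonneg.2 hp0.le)]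
    gcongr
  · have h1 := (EReal.tendsto_coe.2 hlim).limsup_eq
    rw [← h1]
    refine limsup_le_limsup (Eventually.of_forall fun n => ?_)
    dsimp only
    rw [EReal.coe_mul, ← ENNReal.log_ofReal_of_pos (hB n)]
    have h2 : (0 : EReal) ≤ (((1 - p) ^ n : ℝ) : EReal) := by
      have : 0 ≤ (1 - p) ^ n := pow_nonneg (by linarith) n
      exact_mod_cast this
    gcongr
    rw [eLpNorm_exponent_top]
    exact eLpNormEssSup_le_of_ae_bound (ae_of_all _ (hfB n))

lemma testClass_mono {p θ θ' : ℝ} (h : θ ≤ θ') (M : ℕ → ℝ) :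
    testClass 𝕜 p θ M ⊆ testClass 𝕜 p θ' M :=
  fun _ hf => ⟨hf.1, hf.2.1, hf.2.2.trans (by exact_mod_cast h)⟩

lemma eLpNorm_iteratedDeriv_le_quasinorm {p : ℝ} {M : ℕ → ℝ} (hM : ∀ n, 0 < M n) (f : ℝ → 𝕜)
    (n : ℕ) : eLpNorm (iteratedDeriv n f) (ENNReal.ofReal p) volume
      ≤ quasinorm p M f * ENNReal.ofReal (M n) := by
  rw [← ENNReal.div_le_iff (by simpa using hM n) ENNReal.ofReal_ne_top]
  exact le_iSup (fun k => eLpNorm (iteratedDeriv k f) (ENNReal.ofReal p) volume /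
    ENNReal.ofReal (M k)) n

lemma continuous_iteratedDeriv_of_smooth {f : ℝ → 𝕜} (hf : ContDiff ℝ ∞ f) (n : ℕ) :
    Continuous (iteratedDeriv n f) :=
  (contDiff_infty.1 hf n).continuous_iteratedDeriv'

lemma memLp_iteratedDeriv {p θ : ℝ} {M : ℕ → ℝ} (hM : ∀ n, 0 < M n) {f : ℝ → 𝕜}
    (hf : f ∈ testClass 𝕜 p θ M) (n : ℕ) :
    MemLp (iteratedDeriv n f) (ENNReal.ofReal p) volume :=
  ⟨(continuous_iteratedDeriv_of_smooth hf.1 n).aestronglyMeasurable,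
    (eLpNorm_iteratedDeriv_le_quasinorm hM f n).trans_lt
      (ENNReal.mul_lt_top hf.2.1 ENNReal.ofReal_lt_top)⟩

lemma quasinorm_zero (p : ℝ) (M : ℕ → ℝ) : quasinorm p M (0 : ℝ → 𝕜) = 0 := by
  have : ∀ k, iteratedDeriv k (0 : ℝ → 𝕜) = 0 := fun k => by
    ext x
    exact iteratedDeriv_const_zero
  simp [quasinorm, this]

lemma zero_mem_testClass {p : ℝ} (hp1 : p < 1) {θ : ℝ} (M : ℕ → ℝ) :
    (0 : ℝ → 𝕜) ∈ testClass 𝕜 p θ M := by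
  refine ⟨contDiff_const, by simp [quasinorm_zero], ?_⟩
  have : ∀ k, iteratedDeriv k (0 : ℝ → 𝕜) = 0 := fun k => by
    ext x
    exact iteratedDeriv_const_zero
  -- Since `log 0 = ⊥` and the factor is positive, the limsup is `⊥`, below every real `θ`.
  have h : ∀ n : ℕ, (((1 - p) ^ n : ℝ) : EReal) *
      ENNReal.log (eLpNorm (iteratedDeriv n (0 : ℝ → 𝕜)) ∞ volume) = ⊥ := fun n => by
    rw [this]
    simp only [eLpNorm_zero, ENNReal.log_zero]
    exact EReal.coe_mul_bot_of_pos (pow_pos (by linarith) n)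
  simp_rw [h]
  simp

/-- The element `(f, f', f'', …)` of the `L^p`-Carleman class defined by a test function. -/
lemma toLp_mem_lpCarlemanClass {p θ : ℝ} {M : ℕ → ℝ} (hM : ∀ n, 0 < M n) {f : ℝ → 𝕜}
    (hf : f ∈ testClass 𝕜 p θ M) :
    (fun n => (memLp_iteratedDeriv hM hf n).toLp _ : LpSeq 𝕜 p) ∈ lpCarlemanClass 𝕜 p θ M := by
  refine ⟨fun n => (memLp_iteratedDeriv hM hf n).toLp _, ⟨fun _ => f, fun _ => hf, ?_, ?_⟩,
    1, one_pos, ?_⟩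
  · intro ε _
    exact ⟨0, fun i _ j _ => by simp [quasinorm_zero]⟩
  · intro n
    refine tendsto_const_nhds.congr fun j => ?_
    rw [← eLpNorm_zero (p := ENNReal.ofReal p) (μ := (volume : Measure ℝ)) (ε := 𝕜)]
    refine eLpNorm_congr_ae ?_
    filter_upwards [(memLp_iteratedDeriv hM hf n).coeFn_toLp] with x hx
    simp [hx]
  · intro n
    simp

/-- A nonzero test function that is flat at a point prevents quasianalyticity. -/
theorem not_isQuasianalyticLp_of_testClass {p θ : ℝ} (hp1 : p < 1) {M : ℕ → ℝ}
    (hM : ∀ n, 0 < M n) {f : ℝ → 𝕜} (hf : f ∈ testClass 𝕜 p θ M) (hf0 : f ≠ 0) {a : ℝ}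
    (ha : ∀ n, iteratedDeriv n f a = 0) :
    ¬ IsQuasianalyticLp (lpCarlemanClass 𝕜 p θ M) := by
  intro hq
  have hz : (0 : ℝ → 𝕜) ∈ testClass 𝕜 p θ M := zero_mem_testClass hp1 M
  have hrep : ∀ {g : ℝ → 𝕜} (hg : g ∈ testClass 𝕜 p θ M), IsContinuousRep
      (fun n => (memLp_iteratedDeriv hM hg n).toLp _ : LpSeq 𝕜 p) (fun n => iteratedDeriv n g) :=
    fun {g} hg n => ⟨continuous_iteratedDeriv_of_smooth hg.1 n, MemLp.coeFn_toLp _⟩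
  have h := hq _ (toLp_mem_lpCarlemanClass hM hf) _ (toLp_mem_lpCarlemanClass hM hz) _ _
    (hrep hf) (hrep hz) a fun n => by
      rw [ha n]
      exact iteratedDeriv_const_zero.symm
  have h0 := congrFun h 0
  rw [MemLp.toLp_eq_toLp_iff, iteratedDeriv_zero, iteratedDeriv_zero] at h0
  exact hf0 ((Continuous.ae_eq_iff_eq _ hf.1.continuous hz.1.continuous).1 h0)

/-- Non-quasianalyticity from a summable sequence of box widths. -/
theorem not_isQuasianalyticLp_of_summable {p θ θ' c : ℝ} (hp0 : 0 < p) (hp1 : p < 1)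
    (hθ : θ' ≤ θ) {M : ℕ → ℝ} (hM : ∀ n, 0 < M n) {a B t : ℕ → ℝ} (ha : ∀ n, 0 < a n)
    (hs : Summable a) (hprod : ∀ n, ∏ i ∈ Finset.range (n + 1), a i = 2 ^ (n + 1) / B n)
    (ht : ∀ n, ∑' k, a (n + k) ≤ t n) (hc : ∀ n, (2 ^ n * t n) ^ p⁻¹ * B n ≤ c * M n)
    (hlim : Tendsto (fun n => (1 - p) ^ n * Real.log (B n)) atTop (𝓝 θ')) :
    ¬ IsQuasianalyticLp (lpCarlemanClass 𝕜 p θ M) := by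
  -- Positivity is read off from `hprod`; as division by zero gives zero, this also excludes `B n =
  -- 0`.
  have hB : ∀ n, 0 < B n := fun n => by
    have h := hprod n ▸ Finset.prod_pos fun i (_ : i ∈ Finset.range (n + 1)) => ha i
    by_contra! h'
    exact absurd h (not_lt.2 (div_nonpos_of_nonneg_of_nonpos (by positivity) h'))
  obtain ⟨f, hf, hf0, hfa, hfB, hfS⟩ := exists_iterated_convolution ha hs
  have hf' : ContDiff ℝ ∞ (fun x => (f x : 𝕜)) := 
    (RCLike.ofRealCLM (K := 𝕜)).contDiff.comp hf
  refine not_isQuasianalyticLp_of_testClass hp1 hM (f := fun x => (f x : 𝕜)) (a := -1)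
    (testClass_mono hθ M (mem_testClass_of_bounds (c := c) hp0 hp1 hM hf' hB
      (V := fun n => 2 ^ n * t n) ?_ ?_ ?_ hc hlim)) ?_ ?_
  · intro n
    have := (tsum_nonneg fun k => (ha (n + k)).le).trans (ht n)
    positivity
  · intro n x
    rw [norm_iteratedDeriv_ofReal hf]
    refine (hfB n x).trans (le_of_eq ?_)
    rw [hprod, div_div_cancel₀ (by positivity)]
  · intro n
    obtain ⟨S, hS, hv, h0⟩ := hfS n
    refine ⟨S, hS, hv.trans (ENNReal.ofReal_le_ofReal ?_), fun x hx => ?_⟩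
    · gcongr
      exact ht n
    · rw [← norm_eq_zero, norm_iteratedDeriv_ofReal hf, h0 x hx, abs_zero]
  · intro h
    refine hf0 (funext fun x => ?_)
    simpa using congrFun h x
  · intro n
    rw [← norm_eq_zero, norm_iteratedDeriv_ofReal hf, hfa n, abs_zero]

/-- With widths of order `exp (-θ p r ^ n)`, `r = 1 / (1 - p)`, the sup norm of the `n`-th
derivative may grow like `exp (θ r ^ n)`, just what the test class allows. The carrier contributes
`exp (-θ r ^ n)` to the `L^p` quasinorm and cancels this growth. The factor `exp l = 2 ^ (1 / p)` in
the widths offsets the doubling of the carrier. -/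
theorem not_isQuasianalyticLp_of_pos {p θ : ℝ} (hp0 : 0 < p) (hp1 : p < 1) (hθ : 0 < θ)
    {M : ℕ → ℝ} (hM : ∀ n, 0 < M n) (hbdd : ∃ c : ℝ, 0 < c ∧ ∀ n, c ≤ M n) :
    ¬ IsQuasianalyticLp (lpCarlemanClass 𝕜 p θ M) := by
  obtain ⟨c, hc, hcM⟩ := hbdd
  set q : ℝ := 1 - p with hq
  have hq0 : 0 < q := by linarith
  set r : ℝ := q⁻¹ with hr
  have hr1 : 1 < r := (one_lt_inv₀ hq0).2 (by linarith)
  have hqr : q * r = 1 := mul_inv_cancel₀ hq0.ne'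
  set l : ℝ := Real.log 2 / p with hl
  set ρ : ℝ := Real.exp (-(θ * p * (r - 1))) with hρ
  have hρ0 : 0 < ρ := Real.exp_pos _
  have hρ1 : ρ < 1 := by
    rw [hρ, Real.exp_lt_one_iff]
    have : 0 < r - 1 := by linarith
    simp only [Left.neg_neg_iff]
    positivity
  set a : ℕ → ℝ := fun n => 2 * Real.exp (l - θ * p * r ^ n) with ha
  -- By Bernoulli, `r ^ (n + k) ≥ r ^ n + k (r - 1)`; hence each tail of the widths is comparable to
  -- its first term.
  have hstep : ∀ n k, a (n + k) ≤ a n * ρ ^ k := by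
    intro n k
    rw [ha, hρ, ← Real.exp_nat_mul]
    dsimp only
    rw [mul_assoc 2 (Real.exp _) (Real.exp _), ← Real.exp_add]
    gcongr
    have h1 : 1 + (k : ℝ) * (r - 1) ≤ r ^ k := by
      simpa using one_add_mul_le_pow (show (-2 : ℝ) ≤ r - 1 by linarith) k
    have h2 : (1 : ℝ) ≤ r ^ n := one_le_pow₀ hr1.le
    have h3 : (0 : ℝ) ≤ k * (r - 1) := mul_nonneg k.cast_nonneg (by linarith)
    have h4 : r ^ n + k * (r - 1) ≤ r ^ (n + k) := by
      rw [pow_add]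
      nlinarith
    have h5 : 0 < θ * p := by positivity
    nlinarith
  have hgeo := summable_geometric_of_lt_one hρ0.le hρ1
  have ha0 : ∀ n, 0 < a n := fun n => by positivity
  have hs : Summable a := Summable.of_nonneg_of_le (fun n => (ha0 n).le)
    (fun n => by simpa using hstep 0 n) (hgeo.mul_left (a 0))
  set K : ℝ := (1 - ρ)⁻¹ with hK
  have hK0 : 0 < K := inv_pos.2 (by linarith)
  -- The exponent in `B` is a geometric sum: as `r - 1 = p / q`, `p (1 + r + ⋯ + r ^ n) = r ^ n -
  -- q`.
  refine not_isQuasianalyticLp_of_summable (c := (2 * K) ^ p⁻¹ *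
    Real.exp (-l + l * p⁻¹ - θ * q) / c) (a := a) (θ' := θ)
    (B := fun n => Real.exp (-((n + 1) * l) + θ * (r ^ n - q))) (t := fun n => a n * K)
    hp0 hp1 le_rfl hM ha0 hs ?_ ?_ ?_ ?_
  · intro n
    rw [div_eq_mul_inv, ← Real.exp_neg]
    induction n with
    | zero =>
      simp only [zero_add, Finset.prod_range_one, ha]
      norm_num
      rw [hq]
      ring
    | succ n ih =>
      rw [Finset.prod_range_succ, ih, ha]
      dsimp only
      rw [show ∀ x y z w : ℝ, x * y * (z * w) = x * z * (y * w) by intros; ring, ← Real.exp_add,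
        ← pow_succ]
      congr 2
      have : r ^ n = q * r ^ (n + 1) := by rw [pow_succ', ← mul_assoc, hqr, one_mul]
      push_cast
      rw [this, hq]
      ring
  · intro n
    have h1 : Summable fun k => a n * ρ ^ k := hgeo.mul_left _
    have h2 : Summable fun k => a (n + k) :=
      Summable.of_nonneg_of_le (fun k => (ha0 _).le) (hstep n) h1
    refine (h2.tsum_le_tsum (hstep n) h1).trans (le_of_eq ?_)
    rw [tsum_mul_left, tsum_geometric_of_lt_one hρ0.le hρ1]
  · intro n
    have h1 : (2 : ℝ) ^ n * (a n * K) = 2 * K * Real.exp (n * Real.log 2 + l - θ * p * r ^ n) := by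
      rw [add_sub_assoc, Real.exp_add, Real.exp_nat_mul, Real.exp_log two_pos, ha]
      ring
    rw [h1, Real.mul_rpow (by positivity) (Real.exp_pos _).le, ← Real.exp_mul, mul_assoc,
      ← Real.exp_add]
    have h3 : (n * Real.log 2 + l - θ * p * r ^ n) * p⁻¹ + (-((n + 1) * l) + θ * (r ^ n - q))
        = -l + l * p⁻¹ - θ * q := by
      rw [hl]
      field_simp
      ring
    rw [h3]
    exact (le_mul_of_one_le_left (by positivity) ((one_le_div hc).2 (hcM n))).trans_eq
      (div_mul_comm _ _ _)
  · simp only [Real.log_exp]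
    have h1 := tendsto_self_mul_const_pow_of_lt_one hq0.le (show q < 1 by linarith)
    have h2 := tendsto_pow_atTop_nhds_zero_of_lt_one hq0.le (show q < 1 by linarith)
    have h3 : Tendsto (fun n : ℕ => -(l * (n * q ^ n)) - (l + θ * q) * q ^ n + θ) atTop
        (𝓝 (-(l * 0) - (l + θ * q) * 0 + θ)) :=
      (((h1.const_mul l).neg.sub (h2.const_mul _)).add_const θ)
    simp only [mul_zero, neg_zero, sub_zero, zero_add] at h3
    refine h3.congr fun n => ?_
    have : q ^ n * r ^ n = 1 := by rw [← mul_pow, hqr, one_pow]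
    linear_combination (-θ) * this

end TestFunctions

/-! ### The associated weight as a weighted geometric mean. -/

section Weights

variable {p : ℝ} {M : ℕ → ℝ}

lemma sum_Icc_one_eq_sum_range (u : ℕ → ℝ) (n : ℕ) :
    ∑ j ∈ Finset.Icc 1 n, u j = ∑ j ∈ Finset.range n, u (j + 1) := by
  rw [Finset.range_eq_Ico, Finset.sum_Ico_add' u 0 n 1]
  rfl

lemma summable_pow_mul_log (hp0 : 0 < p) (hp1 : p < 1)
    (hbdd : ∃ c : ℝ, 0 < c ∧ ∀ n, c ≤ M n) (hκ : pCharacteristic p M < ⊤) :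
    Summable fun j : ℕ => (1 - p) ^ j * Real.log (M j) := by
  obtain ⟨c, hc, hcM⟩ := hbdd
  obtain ⟨K, hK, -⟩ := EReal.lt_iff_exists_real_btwn.1 hκ
  have hev := eventually_lt_of_limsup_lt hK
  set q : ℝ := 1 - p with hq
  have hq0 : 0 < q := by linarith
  have hgeo : Summable fun j : ℕ => q ^ (j + 1) * Real.log c :=
    ((summable_nat_add_iff 1).2 (summable_geometric_of_lt_one hq0.le (by linarith))).mul_right _
  have hnn : ∀ j : ℕ, 0 ≤ q ^ (j + 1) * Real.log (M (j + 1)) - q ^ (j + 1) * Real.log c :=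
    fun j => by
      rw [← mul_sub]
      exact mul_nonneg (pow_nonneg hq0.le _) (sub_nonneg.2 (Real.log_le_log hc (hcM _)))
  obtain ⟨b, hb⟩ := hgeo.hasSum.tendsto_sum_nat.bddBelow_range
  -- Subtracting the summable lower bound leaves nonnegative terms, for which bounded partial sums
  -- suffice.
  have h : Summable fun j : ℕ =>
      q ^ (j + 1) * Real.log (M (j + 1)) - q ^ (j + 1) * Real.log c := by
    refine summable_of_sum_range_le (c := K - b) hnn fun n => ?_
    obtain ⟨m, hm, hnm⟩ := (hev.and (eventually_ge_atTop n)).exists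
    refine (Finset.sum_le_sum_of_subset_of_nonneg (Finset.range_mono hnm)
      fun j _ _ => hnn j).trans ?_
    rw [Finset.sum_sub_distrib]
    have h1 := EReal.coe_lt_coe_iff.1 hm
    rw [sum_Icc_one_eq_sum_range] at h1
    have h2 := hb ⟨m, rfl⟩
    dsimp only at h2
    linarith
  rw [← summable_nat_add_iff 1]
  simpa using h.add hgeo

lemma tendsto_pow_mul_log (hp0 : 0 < p) (hp1 : p < 1)
    (hbdd : ∃ c : ℝ, 0 < c ∧ ∀ n, c ≤ M n) (hκ : pCharacteristic p M < ⊤) :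
    Tendsto (fun j : ℕ => (1 - p) ^ j * Real.log (M j)) atTop (𝓝 0) :=
  (summable_pow_mul_log hp0 hp1 hbdd hκ).tendsto_atTop_zero

lemma summable_associatedWeight (hp1 : p < 1)
    (hs : Summable fun j : ℕ => (1 - p) ^ j * Real.log (M j)) (n : ℕ) :
    Summable fun j : ℕ => p * (1 - p) ^ j * Real.log (M (n + (j + 1))) := by
  have h := ((summable_nat_add_iff (n + 1)).2 hs).mul_left (p * ((1 - p) ^ (n + 1))⁻¹)
  refine h.congr fun j => ?_
  have : (1 - p) ^ (n + 1) ≠ 0 := pow_ne_zero _ (by linarith)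
  rw [show n + (j + 1) = j + (n + 1) by ring, pow_add _ j]
  field_simp

/-- Summability of the logarithms makes the infinite product genuine, rather than the default value
1. -/
lemma associatedWeight_eq_exp (hp1 : p < 1) (hM : ∀ n, 0 < M n)
    (hs : Summable fun j : ℕ => (1 - p) ^ j * Real.log (M j)) (n : ℕ) :
    associatedWeight p M n
      = Real.exp (∑' j : ℕ, p * (1 - p) ^ j * Real.log (M (n + (j + 1)))) := by
  rw [associatedWeight, ← Real.rexp_tsum_eq_tprod (fun j => Real.rpow_pos_of_pos (hM _) _)]
  · simp only [Real.log_rpow (hM _)]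
  · simp only [Real.log_rpow (hM _)]
    exact summable_associatedWeight hp1 hs n

/-- This recursion is the equality case of the inequality between the sup norms of consecutive
derivatives. -/
lemma associatedWeight_eq_mul (hp1 : p < 1) (hM : ∀ n, 0 < M n)
    (hs : Summable fun j : ℕ => (1 - p) ^ j * Real.log (M j)) (n : ℕ) :
    associatedWeight p M n = M (n + 1) ^ p * associatedWeight p M (n + 1) ^ (1 - p) := by
  rw [associatedWeight_eq_exp hp1 hM hs, associatedWeight_eq_exp hp1 hM hs,
    (summable_associatedWeight hp1 hs n).tsum_eq_zero_add, Real.exp_add,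
    Real.rpow_def_of_pos (hM _), ← Real.exp_mul, ← tsum_mul_right]
  congr 2
  · simp [mul_comm]
  · refine tsum_congr fun j => ?_
    rw [show n + (j + 1 + 1) = n + 1 + (j + 1) by ring, pow_succ]
    ring

/-- The exponents `p (1 - p) ^ j` have total mass one, so the associated weight is a weighted
geometric mean of later terms of `M` and inherits lower bounds. -/
lemma tsum_mul_geometric (hp0 : 0 < p) (hp1 : p < 1) (x : ℝ) :
    HasSum (fun j : ℕ => p * (1 - p) ^ j * x) x := by
  have h := ((hasSum_geometric_of_lt_one (show 0 ≤ 1 - p by linarith) (by linarith)).mul_left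
    p).mul_right x
  simpa [hp0.ne'] using h

lemma le_associatedWeight (hp0 : 0 < p) (hp1 : p < 1) (hM : ∀ n, 0 < M n) {c : ℝ} (hc : 0 < c)
    (hcM : ∀ n, c ≤ M n)
    (hs : Summable fun j : ℕ => (1 - p) ^ j * Real.log (M j)) (n : ℕ) :
    c ≤ associatedWeight p M n := by
  rw [associatedWeight_eq_exp hp1 hM hs, ← Real.log_le_iff_le_exp hc,
    ← (tsum_mul_geometric hp0 hp1 (Real.log c)).tsum_eq]
  refine (tsum_mul_geometric hp0 hp1 (Real.log c)).summable.tsum_le_tsum (fun j => ?_)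
    (summable_associatedWeight hp1 hs n)
  have : 0 ≤ 1 - p := by linarith
  have := Real.log_le_log hc (hcM (n + (j + 1)))
  gcongr

end Weights

/-! ### Sup norm bounds from `L^p` bounds. -/

section SupBounds

variable {𝕜 : Type*} [RCLike 𝕜]

lemma lintegral_enorm_le_eLpNorm_mul {p : ℝ} (hp0 : 0 < p) (hp1 : p < 1) {g : ℝ → 𝕜}
    (hg : Continuous g) : ∫⁻ x, ‖g x‖ₑ
      ≤ eLpNorm g (ENNReal.ofReal p) volume ^ p * eLpNorm g ∞ volume ^ (1 - p) := by
  have h1 : eLpNorm g (ENNReal.ofReal p) volume ^ p = ∫⁻ x, ‖g x‖ₑ ^ p := by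
    rw [eLpNorm_eq_lintegral_rpow_enorm_toReal (by simpa using hp0) ENNReal.ofReal_ne_top,
      ENNReal.toReal_ofReal hp0.le, ← ENNReal.rpow_mul, one_div, inv_mul_cancel₀ hp0.ne',
      ENNReal.rpow_one]
  have hm : Measurable fun x => ‖g x‖ₑ ^ p := (hg.measurable.enorm).pow_const p
  rw [h1, ← lintegral_mul_const _ hm, eLpNorm_exponent_top]
  refine lintegral_mono_ae ?_
  filter_upwards [ae_le_eLpNormEssSup (f := g) (μ := volume)] with x hx
  calc ‖g x‖ₑ = ‖g x‖ₑ ^ p * ‖g x‖ₑ ^ (1 - p) := by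
        rw [← ENNReal.rpow_add_of_nonneg _ _ hp0.le (by linarith)]
        simp
    _ ≤ _ := by
        have : 0 ≤ 1 - p := by linarith
        gcongr

/-- If it failed at `x`, the oscillation of `f` would be too small to come down from `‖f x‖`, and
`‖f‖` would be bounded below by a positive constant on the whole line, contradicting `f ∈ L^p`. -/
lemma enorm_le_lintegral_deriv {p : ℝ} (hp0 : 0 < p) {f : ℝ → 𝕜} (hf : ContDiff ℝ 1 f)
    (hfp : eLpNorm f (ENNReal.ofReal p) volume < ⊤) (x : ℝ) :
    ‖f x‖ₑ ≤ ∫⁻ t, ‖deriv f t‖ₑ := by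
  by_contra! hlt
  have hcont : Continuous (deriv f) := hf.continuous_deriv le_rfl
  have hint : Integrable (deriv f) volume :=
    ⟨hcont.aestronglyMeasurable, hlt.trans_le le_top⟩
  set I : ℝ := ∫ t, ‖deriv f t‖ with hI
  have hIx : I < ‖f x‖ := by
    rw [hI, integral_norm_eq_lintegral_enorm hcont.aestronglyMeasurable, ← toReal_enorm (f x)]
    exact (ENNReal.toReal_lt_toReal (hlt.trans_le le_top).ne enorm_ne_top).2 hlt
  have hy : ∀ y, ‖f x - f y‖ ≤ I := by
    intro y
    rw [← intervalIntegral.integral_eq_sub_of_hasDerivAt (f := f) (f' := deriv f)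
      (fun t _ => (hf.differentiable one_ne_zero t).hasDerivAt) (hcont.intervalIntegrable _ _)]
    refine intervalIntegral.norm_integral_le_integral_norm_uIoc.trans ?_
    exact setIntegral_le_integral hint.norm (ae_of_all _ fun t => norm_nonneg _)
  have hmem : MemLp f (ENNReal.ofReal p) volume :=
    ⟨hf.continuous.aestronglyMeasurable, hfp⟩
  have hconst : MemLp (fun _ : ℝ => ‖f x‖ - I) (ENNReal.ofReal p) volume := by
    refine hmem.mono aestronglyMeasurable_const (ae_of_all _ fun y => ?_)
    rw [Real.norm_of_nonneg (by linarith)]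
    have := norm_sub_norm_le (f x) (f y)
    linarith [hy y]
  rw [memLp_const_iff (by simpa using hp0) ENNReal.ofReal_ne_top] at hconst
  simp only [Real.volume_univ, lt_self_iff_false, or_false] at hconst
  linarith

lemma eLpNorm_top_le_deriv {p : ℝ} (hp0 : 0 < p) (hp1 : p < 1) {f : ℝ → 𝕜}
    (hf : ContDiff ℝ 1 f) (hfp : eLpNorm f (ENNReal.ofReal p) volume < ⊤) :
    eLpNorm f ∞ volume ≤ eLpNorm (deriv f) (ENNReal.ofReal p) volume ^ p
      * eLpNorm (deriv f) ∞ volume ^ (1 - p) := by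
  refine le_trans ?_ (lintegral_enorm_le_eLpNorm_mul hp0 hp1 (hf.continuous_deriv le_rfl))
  rw [eLpNorm_exponent_top]
  exact eLpNormEssSup_le_of_ae_enorm_bound (ae_of_all _ (enorm_le_lintegral_deriv hp0 hf hfp))

/-- The sup norms of the derivatives satisfy `limsup (1 - p) ^ n log ‖f^{(n)}‖_∞ ≤ 0`. -/
def IsTame (p : ℝ) (f : ℝ → 𝕜) : Prop :=
  ∀ δ : ℝ, 0 < δ → ∀ᶠ n : ℕ in atTop, eLpNorm (iteratedDeriv n f) ∞ volume
    ≤ ENNReal.ofReal (Real.exp (δ * ((1 - p) ^ n)⁻¹))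

lemma isTame_of_mem_testClass {p : ℝ} (hp1 : p < 1) {M : ℕ → ℝ} {f : ℝ → 𝕜}
    (hf : f ∈ testClass 𝕜 p 0 M) : IsTame p f := by
  intro δ hδ
  have h : limsup (fun n : ℕ => (((1 - p) ^ n : ℝ) : EReal) *
      ENNReal.log (eLpNorm (iteratedDeriv n f) ∞ volume)) atTop < (δ : EReal) :=
    hf.2.2.trans_lt (by exact_mod_cast hδ)
  filter_upwards [eventually_lt_of_limsup_lt h] with n hn
  by_contra! hlt
  refine absurd hn (not_lt.2 ?_)
  have hq : 0 < (1 - p) ^ n := pow_pos (by linarith) n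
  have h1 := ENNReal.log_le_log hlt.le
  rw [ENNReal.log_ofReal_of_pos (Real.exp_pos _), Real.log_exp] at h1
  have h2 : (δ : EReal) = (((1 - p) ^ n : ℝ) : EReal) * ((δ * ((1 - p) ^ n)⁻¹ : ℝ) : EReal) := by
    rw [← EReal.coe_mul, mul_comm δ, mul_inv_cancel_left₀ hq.ne']
  rw [h2]
  have h3 : (0 : EReal) ≤ (((1 - p) ^ n : ℝ) : EReal) := by exact_mod_cast hq.le
  gcongr

lemma eventually_le_exp_mul_inv_pow {p : ℝ} (hp0 : 0 < p) (hp1 : p < 1) (C : ℝ) {δ : ℝ}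
    (hδ : 0 < δ) : ∀ᶠ n : ℕ in atTop, C ≤ Real.exp (δ * ((1 - p) ^ n)⁻¹) := by
  have h1 : Tendsto (fun n : ℕ => (((1 - p)⁻¹) ^ n : ℝ)) atTop atTop :=
    tendsto_pow_atTop_atTop_of_one_lt ((one_lt_inv₀ (by linarith)).2 (by linarith))
  have h2 := (Real.tendsto_exp_atTop.comp (h1.const_mul_atTop hδ)).eventually_ge_atTop C
  simpa only [Function.comp_apply, inv_pow] using h2

lemma iteratedDeriv_sub_of_smooth {f g : ℝ → 𝕜} (hf : ContDiff ℝ ∞ f) (hg : ContDiff ℝ ∞ g)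
    (n : ℕ) : iteratedDeriv n (f - g) = iteratedDeriv n f - iteratedDeriv n g := by
  ext x
  exact iteratedDeriv_sub (contDiff_infty.1 hf n).contDiffAt (contDiff_infty.1 hg n).contDiffAt

/-- The Cauchy condition concerns differences of test functions, and the sup bound has to apply to
these. -/
lemma IsTame.sub {p : ℝ} (hp0 : 0 < p) (hp1 : p < 1) {f g : ℝ → 𝕜} (hf : ContDiff ℝ ∞ f)
    (hg : ContDiff ℝ ∞ g) (hft : IsTame p f) (hgt : IsTame p g) : IsTame p (f - g) := by
  intro δ hδ
  filter_upwards [hft (δ / 2) (half_pos hδ), hgt (δ / 2) (half_pos hδ),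
    eventually_le_exp_mul_inv_pow hp0 hp1 2 (half_pos hδ)] with n h1 h2 h3
  rw [iteratedDeriv_sub_of_smooth hf hg]
  refine (eLpNorm_sub_le (continuous_iteratedDeriv_of_smooth hf n).aestronglyMeasurable
    (continuous_iteratedDeriv_of_smooth hg n).aestronglyMeasurable le_top).trans ?_
  refine (add_le_add h1 h2).trans ?_
  rw [← ENNReal.ofReal_add (Real.exp_pos _).le (Real.exp_pos _).le]
  refine ENNReal.ofReal_le_ofReal ?_
  rw [show δ * ((1 - p) ^ n)⁻¹ = δ / 2 * ((1 - p) ^ n)⁻¹ + δ / 2 * ((1 - p) ^ n)⁻¹ by ring,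
    Real.exp_add]
  nlinarith [Real.exp_pos (δ / 2 * ((1 - p) ^ n)⁻¹)]

/-- A sequence with `r n ≤ r (n + 1) ^ (1 - p)` and slow growth is bounded by one. -/
lemma le_one_of_le_rpow {p : ℝ} (hp1 : p < 1) {r : ℕ → ℝ≥0∞}
    (hr : ∀ n, r n ≤ r (n + 1) ^ (1 - p))
    (hg : ∀ δ : ℝ, 0 < δ → ∀ᶠ n : ℕ in atTop,
      r n ≤ ENNReal.ofReal (Real.exp (δ * ((1 - p) ^ n)⁻¹))) (n : ℕ) : r n ≤ 1 := by
  have hq : 0 < 1 - p := by linarith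
  -- Inserting the growth bound at `n + m` leaves `exp (δ (1 - p) ^ (-n))`, free of `m`; then `δ →
  -- 0`.
  have hit : ∀ m, r n ≤ r (n + m) ^ ((1 - p) ^ m) := by
    intro m
    induction m with
    | zero => simp
    | succ m ih =>
      refine ih.trans ?_
      rw [pow_succ', ENNReal.rpow_mul]
      exact ENNReal.rpow_le_rpow (hr _) (pow_pos hq m).le
  have hδ : ∀ δ : ℝ, 0 < δ → r n ≤ ENNReal.ofReal (Real.exp (δ * ((1 - p) ^ n)⁻¹)) := by
    intro δ hδ
    obtain ⟨k, hk, hnk⟩ := ((hg δ hδ).and (eventually_ge_atTop n)).exists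
    obtain ⟨m, rfl⟩ := Nat.exists_eq_add_of_le hnk
    refine (hit m).trans ((ENNReal.rpow_le_rpow hk (pow_pos hq m).le).trans (le_of_eq ?_))
    rw [ENNReal.ofReal_rpow_of_pos (Real.exp_pos _), ← Real.exp_mul, pow_add, mul_inv]
    congr 2
    rw [mul_assoc, mul_assoc, inv_mul_cancel₀ (pow_pos hq m).ne', mul_one]
  have hlim : Tendsto (fun δ : ℝ => ENNReal.ofReal (Real.exp (δ * ((1 - p) ^ n)⁻¹)))
      (𝓝[>] 0) (𝓝 1) := by
    have : Continuous fun δ : ℝ => ENNReal.ofReal (Real.exp (δ * ((1 - p) ^ n)⁻¹)) :=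
      ENNReal.continuous_ofReal.comp (by fun_prop)
    have h := this.tendsto 0
    simp only [zero_mul, Real.exp_zero, ENNReal.ofReal_one] at h
    exact h.mono_left nhdsWithin_le_nhds
  exact ge_of_tendsto hlim (eventually_nhdsWithin_of_forall hδ)

/-- The sup norms of the derivatives of a tame function are controlled by its quasinorm and the
associated weight. -/
theorem eLpNorm_top_iteratedDeriv_le {p : ℝ} (hp0 : 0 < p) (hp1 : p < 1) {M : ℕ → ℝ}
    (hM : ∀ n, 0 < M n) (hbdd : ∃ c : ℝ, 0 < c ∧ ∀ n, c ≤ M n)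
    (hs : Summable fun j : ℕ => (1 - p) ^ j * Real.log (M j)) {f : ℝ → 𝕜}
    (hf : ContDiff ℝ ∞ f) (hft : IsTame p f) {K : ℝ} (hK : 0 < K)
    (hfK : quasinorm p M f ≤ ENNReal.ofReal K) (n : ℕ) :
    eLpNorm (iteratedDeriv n f) ∞ volume ≤ ENNReal.ofReal (K * associatedWeight p M n) := by
  obtain ⟨c, hc, hcM⟩ := hbdd
  have hq : 0 < 1 - p := by linarith
  have hN : ∀ n, c ≤ associatedWeight p M n := le_associatedWeight hp0 hp1 hM hc hcM hs
  have hD : ∀ n, 0 < K * associatedWeight p M n := fun n => mul_pos hK (hc.trans_le (hN n))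
  have hLp : ∀ n, eLpNorm (iteratedDeriv n f) (ENNReal.ofReal p) volume
      ≤ ENNReal.ofReal (K * M n) := fun n => by
    rw [ENNReal.ofReal_mul hK.le]
    exact (eLpNorm_iteratedDeriv_le_quasinorm hM f n).trans (by gcongr)
  have hstep : ∀ n, eLpNorm (iteratedDeriv n f) ∞ volume
      ≤ ENNReal.ofReal (K * M (n + 1)) ^ p
        * eLpNorm (iteratedDeriv (n + 1) f) ∞ volume ^ (1 - p) := by
    intro n
    have h1 : ContDiff ℝ 1 (iteratedDeriv n f) := by
      rw [iteratedDeriv_eq_iterate]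
      exact ContDiff.iterate_deriv' 1 n (contDiff_infty.1 hf (1 + n))
    have h2 := eLpNorm_top_le_deriv hp0 hp1 h1 ((hLp n).trans_lt ENNReal.ofReal_lt_top)
    rw [← iteratedDeriv_succ] at h2
    refine h2.trans ?_
    gcongr
    exact hLp (n + 1)
  have hDrec : ∀ n, ENNReal.ofReal (K * associatedWeight p M n)
      = ENNReal.ofReal (K * M (n + 1)) ^ p
        * ENNReal.ofReal (K * associatedWeight p M (n + 1)) ^ (1 - p) := by
    intro n
    have hKM : 0 < K * M (n + 1) := mul_pos hK (hM _)
    rw [ENNReal.ofReal_rpow_of_pos hKM, ENNReal.ofReal_rpow_of_pos (hD _),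
      ← ENNReal.ofReal_mul (by positivity), associatedWeight_eq_mul hp1 hM hs n,
      Real.mul_rpow hK.le (hM _).le, Real.mul_rpow hK.le (hc.le.trans (hN _))]
    congr 1
    have : K = K ^ p * K ^ (1 - p) := by
      rw [← Real.rpow_add hK]
      simp
    nth_rewrite 1 [this]
    ring
  -- In the ratio the common factor `(K M_{n+1}) ^ p` of `hstep` and `hDrec` cancels. Slow growth of
  -- the ratio follows from tameness, because its denominator is at least `K c`.
  have key := le_one_of_le_rpow hp1 (r := fun n => eLpNorm (iteratedDeriv n f) ∞ volume /
    ENNReal.ofReal (K * associatedWeight p M n)) (fun n => ?_) (fun δ hδ => ?_) n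
  · rwa [ENNReal.div_le_iff (by simpa using hD n) ENNReal.ofReal_ne_top, one_mul] at key
  · have hKM : 0 < K * M (n + 1) := mul_pos hK (hM _)
    refine (ENNReal.div_le_div_right (hstep n) _).trans_eq ?_
    rw [hDrec n, ENNReal.mul_div_mul_left _ _ (by simp [hKM, hp0])
      (ENNReal.rpow_ne_top_of_nonneg hp0.le ENNReal.ofReal_ne_top),
      ENNReal.div_rpow_of_nonneg _ _ hq.le]
  · filter_upwards [hft (δ / 2) (half_pos hδ),
      eventually_le_exp_mul_inv_pow hp0 hp1 (K * c)⁻¹ (half_pos hδ)] with n h1 h2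
    rw [ENNReal.div_le_iff (by simpa using hD n) ENNReal.ofReal_ne_top,
      ← ENNReal.ofReal_mul (Real.exp_pos _).le]
    refine h1.trans (ENNReal.ofReal_le_ofReal ?_)
    rw [show δ * ((1 - p) ^ n)⁻¹ = δ / 2 * ((1 - p) ^ n)⁻¹ + δ / 2 * ((1 - p) ^ n)⁻¹ by ring,
      Real.exp_add, mul_assoc]
    refine le_mul_of_one_le_right (Real.exp_pos _).le ?_
    calc (1 : ℝ) = (K * c)⁻¹ * (K * c) := (inv_mul_cancel₀ (by positivity)).symm
      _ ≤ _ := by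
        gcongr
        exact hN n

lemma norm_le_of_eLpNorm_top_le {g : ℝ → 𝕜} (hg : Continuous g) {C : ℝ} (hC : 0 ≤ C)
    (h : eLpNorm g ∞ volume ≤ ENNReal.ofReal C) (x : ℝ) : ‖g x‖ ≤ C := by
  have hae : ∀ᵐ y, ‖g y‖ ≤ C := by
    filter_upwards [ae_le_eLpNormEssSup (f := g) (μ := volume)] with y hy
    rw [eLpNorm_exponent_top] at h
    have := hy.trans h
    rwa [← ofReal_norm, ENNReal.ofReal_le_ofReal_iff hC] at this
  have hopen : IsOpen {y | C < ‖g y‖} := isOpen_lt continuous_const hg.norm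
  have hz : volume {y | C < ‖g y‖} = 0 := by
    rw [ae_iff] at hae
    simpa using hae
  rw [hopen.measure_eq_zero_iff volume] at hz
  by_contra! hlt
  exact absurd (show x ∈ {y | C < ‖g y‖} from hlt) (by simp [hz])

lemma eLpNorm_top_le_of_norm_le {g : ℝ → 𝕜} {C : ℝ} (h : ∀ x, ‖g x‖ ≤ C) :
    eLpNorm g ∞ volume ≤ ENNReal.ofReal C := by
  rw [eLpNorm_exponent_top]
  exact eLpNormEssSup_le_of_ae_bound (ae_of_all _ h)

end SupBounds

/-! ### Elements of the completion are smooth; sufficiency in (ii). -/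

section SmoothElements

variable {𝕜 : Type*} [RCLike 𝕜]

lemma hasDerivAt_iteratedDeriv {f : ℝ → 𝕜} (hf : ContDiff ℝ ∞ f) (n : ℕ) (x : ℝ) :
    HasDerivAt (iteratedDeriv n f) (iteratedDeriv (n + 1) f x) x := by
  rw [iteratedDeriv_succ]
  exact (hf.differentiable_iteratedDeriv n (by exact_mod_cast ENat.natCast_lt_top n) x).hasDerivAt

/-- A sequence of functions each of which is the derivative of the preceding one. -/
lemma contDiff_of_hasDerivAt_succ {φ : ℕ → ℝ → 𝕜}
    (h : ∀ n x, HasDerivAt (φ n) (φ (n + 1) x) x) :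
    ContDiff ℝ ∞ (φ 0) ∧ ∀ n, iteratedDeriv n (φ 0) = φ n := by
  have hit : ∀ n, iteratedDeriv n (φ 0) = φ n := by
    intro n
    induction n with
    | zero => exact iteratedDeriv_zero
    | succ n ih =>
      rw [iteratedDeriv_succ, ih]
      exact funext fun x => (h n x).deriv
  refine ⟨contDiff_of_differentiable_iteratedDeriv fun n _ => ?_, hit⟩
  rw [hit]
  exact fun x => (h n x).differentiableAt

/-- The elements of the `L^p`-Carleman space with `θ = 0` are the jets of functions in the
classical Carleman class of the associated weight. -/
theorem exists_carlemanClass_of_mem_carlemanSpace {p : ℝ} (hp0 : 0 < p) (hp1 : p < 1) {M : ℕ → ℝ}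
    (hM : ∀ n, 0 < M n) (hbdd : ∃ c : ℝ, 0 < c ∧ ∀ n, c ≤ M n)
    (hs : Summable fun j : ℕ => (1 - p) ^ j * Real.log (M j)) {F : LpSeq 𝕜 p}
    (hF : F ∈ carlemanSpace 𝕜 p 0 M) :
    ∃ φ ∈ carlemanClass 𝕜 (associatedWeight p M),
      ∀ n, (F n : ℝ → 𝕜) =ᵐ[volume] iteratedDeriv n φ := by
  obtain ⟨f, hf, hcau, hlim⟩ := hF
  have hN : ∀ n, 0 < associatedWeight p M n := by
    obtain ⟨c, hc, hcM⟩ := hbdd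
    exact fun n => hc.trans_le (le_associatedWeight hp0 hp1 hM hc hcM hs n)
  have hsm : ∀ j, ContDiff ℝ ∞ (f j) := fun j => (hf j).1
  -- The sup bound is linear in the quasinorm, so `J` serves all orders `n` simultaneously.
  have hunif : ∀ ε : ℝ, 0 < ε → ∃ J : ℕ, ∀ i ≥ J, ∀ j ≥ J, ∀ n x,
      ‖iteratedDeriv n (f i) x - iteratedDeriv n (f j) x‖ ≤ ε * associatedWeight p M n := by
    intro ε hε
    obtain ⟨J, hJ⟩ := hcau (ENNReal.ofReal ε) (by simpa using hε)
    refine ⟨J, fun i hi j hj n x => ?_⟩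
    have h := eLpNorm_top_iteratedDeriv_le hp0 hp1 hM hbdd hs (f := f i - f j)
      ((hsm i).sub (hsm j))
      (IsTame.sub hp0 hp1 (hsm i) (hsm j) (isTame_of_mem_testClass hp1 (hf i))
        (isTame_of_mem_testClass hp1 (hf j))) hε (hJ i hi j hj) n
    rw [iteratedDeriv_sub_of_smooth (hsm i) (hsm j)] at h
    exact norm_le_of_eLpNorm_top_le ((continuous_iteratedDeriv_of_smooth (hsm i) n).sub
      (continuous_iteratedDeriv_of_smooth (hsm j) n)) (mul_pos hε (hN n)).le h x
  have hex : ∀ n x, ∃ y, Tendsto (fun j => iteratedDeriv n (f j) x) atTop (𝓝 y) := by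
    intro n x
    refine cauchySeq_tendsto_of_complete (Metric.cauchySeq_iff.2 fun ε hε => ?_)
    obtain ⟨J, hJ⟩ := hunif (ε / (2 * associatedWeight p M n))
      (div_pos hε (mul_pos two_pos (hN n)))
    refine ⟨J, fun i hi j hj => ?_⟩
    rw [dist_eq_norm]
    refine (hJ i hi j hj n x).trans_lt ?_
    have := (hN n).ne'
    rw [show ε / (2 * associatedWeight p M n) * associatedWeight p M n = ε / 2 by field_simp]
    linarith
  choose φ hφ using hex
  have hclose : ∀ ε : ℝ, 0 < ε → ∃ J : ℕ, ∀ j ≥ J, ∀ n x,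
      ‖φ n x - iteratedDeriv n (f j) x‖ ≤ ε * associatedWeight p M n := by
    intro ε hε
    obtain ⟨J, hJ⟩ := hunif ε hε
    refine ⟨J, fun j hj n x => ?_⟩
    refine le_of_tendsto ((hφ n x).sub_const _).norm ?_
    filter_upwards [eventually_ge_atTop J] with i hi using hJ i hi j hj n x
  have htu : ∀ n, TendstoUniformly (fun j => iteratedDeriv n (f j)) (φ n) atTop := by
    intro n
    rw [Metric.tendstoUniformly_iff]
    intro ε hε
    obtain ⟨J, hJ⟩ := hclose (ε / (2 * associatedWeight p M n))
      (div_pos hε (mul_pos two_pos (hN n)))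
    filter_upwards [eventually_ge_atTop J] with j hj x
    rw [dist_eq_norm]
    refine (hJ j hj n x).trans_lt ?_
    have := (hN n).ne'
    rw [show ε / (2 * associatedWeight p M n) * associatedWeight p M n = ε / 2 by field_simp]
    linarith
  obtain ⟨hφs, hφd⟩ := contDiff_of_hasDerivAt_succ (φ := φ) fun n =>
    hasDerivAt_of_tendstoUniformly (htu (n + 1))
      (Eventually.of_forall fun j => hasDerivAt_iteratedDeriv (hsm j) n) (hφ n)
  refine ⟨φ 0, ⟨hφs, ?_⟩, fun n => ?_⟩
  · obtain ⟨J, hJ⟩ := hclose 1 one_pos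
    set K : ℝ := (quasinorm p M (f J)).toReal + 1 with hK
    have hK0 : 0 < K := by positivity
    have hfK : quasinorm p M (f J) ≤ ENNReal.ofReal K := by
      rw [← ENNReal.ofReal_toReal (hf J).2.1.ne]
      exact ENNReal.ofReal_le_ofReal (by linarith)
    refine ⟨K + 1, 1, by positivity, one_pos, fun n => ?_⟩
    rw [hφd]
    refine eLpNorm_top_le_of_norm_le fun x => ?_
    have h1 := norm_le_of_eLpNorm_top_le (continuous_iteratedDeriv_of_smooth (hsm J) n)
      (mul_pos hK0 (hN n)).le (eLpNorm_top_iteratedDeriv_le hp0 hp1 hM hbdd hs (hsm J)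
        (isTame_of_mem_testClass hp1 (hf J)) hK0 hfK n) x
    have h2 := hJ J le_rfl n x
    have h3 := norm_le_norm_add_norm_sub' (φ n x) (iteratedDeriv n (f J) x)
    rw [one_pow]
    linarith
  · rw [hφd]
    -- The `L^p` limit is identified with the uniform limit along an a.e. convergent subsequence.
    have hmeas := tendstoInMeasure_of_tendsto_eLpNorm (μ := (volume : Measure ℝ))
      (f := fun j => iteratedDeriv n (f j)) (g := (F n : ℝ → 𝕜)) (l := atTop)
      (by simpa using hp0 : ENNReal.ofReal p ≠ 0)
      (fun j => (continuous_iteratedDeriv_of_smooth (hsm j) n).aestronglyMeasurable)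
      (Lp.aestronglyMeasurable _) (hlim n)
    obtain ⟨ns, hns, hae⟩ := hmeas.exists_seq_tendsto_ae
    filter_upwards [hae] with x hx
    exact tendsto_nhds_unique hx ((hφ n x).comp hns.tendsto_atTop)

/-- The factor `|a| ^ k` is absorbed by the geometric constant. Negative `a` is admitted because the
reflection `a = -1` is needed as well as dilations. -/
lemma carlemanClass_comp_mul {N : ℕ → ℝ} (hN : ∀ n, 0 < N n) {φ : ℝ → 𝕜}
    (hφ : φ ∈ carlemanClass 𝕜 N) {a : ℝ} (ha : a ≠ 0) :
    (fun x => φ (a * x)) ∈ carlemanClass 𝕜 N := by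
  obtain ⟨hs, C, A, hC, hA, hb⟩ := hφ
  refine ⟨hs.comp (contDiff_const.mul contDiff_id), C, |a| * A, hC, by positivity, fun k => ?_⟩
  rw [iteratedDeriv_comp_const_smul (contDiff_infty.1 hs k)]
  refine eLpNorm_top_le_of_norm_le fun x => ?_
  have hk : 0 ≤ C * A ^ k * N k := mul_nonneg (by positivity) (hN k).le
  have h1 := norm_le_of_eLpNorm_top_le (continuous_iteratedDeriv_of_smooth hs k) hk (hb k) (a * x)
  rw [norm_smul, norm_pow, Real.norm_eq_abs]
  refine (mul_le_mul_of_nonneg_left h1 (pow_nonneg (abs_nonneg a) k)).trans (le_of_eq ?_)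
  ring

theorem exists_carlemanClass_of_mem_lpCarlemanClass {p : ℝ} (hp0 : 0 < p) (hp1 : p < 1)
    {M : ℕ → ℝ} (hM : ∀ n, 0 < M n) (hbdd : ∃ c : ℝ, 0 < c ∧ ∀ n, c ≤ M n)
    (hs : Summable fun j : ℕ => (1 - p) ^ j * Real.log (M j)) {F : LpSeq 𝕜 p}
    (hF : F ∈ lpCarlemanClass 𝕜 p 0 M) :
    ∃ φ ∈ carlemanClass 𝕜 (associatedWeight p M),
      ∀ n, (F n : ℝ → 𝕜) =ᵐ[volume] iteratedDeriv n φ := by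
  obtain ⟨F', hF', a, ha, hFa⟩ := hF
  obtain ⟨φ, hφ, hae⟩ := exists_carlemanClass_of_mem_carlemanSpace hp0 hp1 hM hbdd hs hF'
  have hN : ∀ n, 0 < associatedWeight p M n := by
    obtain ⟨c, hc, hcM⟩ := hbdd
    exact fun n => hc.trans_le (le_associatedWeight hp0 hp1 hM hc hcM hs n)
  refine ⟨_, carlemanClass_comp_mul hN hφ ha.ne', fun n => ?_⟩
  rw [iteratedDeriv_comp_const_smul (contDiff_infty.1 hφ.1 n)]
  have h := (Measure.quasiMeasurePreserving_smul (volume : Measure ℝ) ha.ne').ae_eq_comp (hae n)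
  filter_upwards [hFa n, h] with x h1 h2
  rw [h1]
  simp only [Function.comp_apply, smul_eq_mul] at h2
  rw [h2]

theorem isQuasianalyticLp_of_isQuasianalytic {p : ℝ} (hp0 : 0 < p) (hp1 : p < 1)
    {M : ℕ → ℝ} (hM : ∀ n, 0 < M n) (hbdd : ∃ c : ℝ, 0 < c ∧ ∀ n, c ≤ M n)
    (hs : Summable fun j : ℕ => (1 - p) ^ j * Real.log (M j))
    (hq : IsQuasianalytic (carlemanClass 𝕜 (associatedWeight p M))) :
    IsQuasianalyticLp (lpCarlemanClass 𝕜 p 0 M) := by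
  intro F hF G hG f g hf hg a hfg
  obtain ⟨φ, hφ, hφF⟩ := exists_carlemanClass_of_mem_lpCarlemanClass hp0 hp1 hM hbdd hs hF
  obtain ⟨ψ, hψ, hψG⟩ := exists_carlemanClass_of_mem_lpCarlemanClass hp0 hp1 hM hbdd hs hG
  have h1 : ∀ n, f n = iteratedDeriv n φ := fun n =>
    (Continuous.ae_eq_iff_eq volume (hf n).1 (continuous_iteratedDeriv_of_smooth hφ.1 n)).1
      ((hf n).2.symm.trans (hφF n))
  have h2 : ∀ n, g n = iteratedDeriv n ψ := fun n =>
    (Continuous.ae_eq_iff_eq volume (hg n).1 (continuous_iteratedDeriv_of_smooth hψ.1 n)).1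
      ((hg n).2.symm.trans (hψG n))
  have h3 : φ = ψ := hq φ hφ ψ hψ a fun n => by rw [← h1, ← h2, hfg]
  funext n
  refine Lp.ext ((hφF n).trans ?_)
  rw [h3]
  exact (hψG n).symm

end SmoothElements

/-! ### Log-convex sequences and the comparison of `N` with `M`. -/

section LogConvex

variable {p : ℝ} {M : ℕ → ℝ}

lemma IsLogConvex.monotone_sub (h : IsLogConvex M) :
    Monotone fun n => Real.log (M (n + 1)) - Real.log (M n) :=
  monotone_nat_of_le_succ fun n => by linarith [h n]

lemma IsLogConvex.mul_le (h : IsLogConvex M) (hM : ∀ n, 0 < M n) (j k : ℕ) :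
    M j * M k ≤ M 0 * M (j + k) := by
  have key : Real.log (M j) + Real.log (M k) ≤ Real.log (M 0) + Real.log (M (j + k)) := by
    induction k with
    | zero => simp [add_comm]
    | succ k ih =>
      have h1 := h.monotone_sub (Nat.le_add_left k j)
      dsimp only at h1
      rw [← add_assoc]
      linarith
  rw [← Real.log_mul (hM _).ne' (hM _).ne', ← Real.log_mul (hM _).ne' (hM _).ne'] at key
  exact (Real.log_le_log_iff (mul_pos (hM _) (hM _)) (mul_pos (hM _) (hM _))).1 key

/-- The increments of `log M` grow at most linearly, so `log M_{n+m} - log M_n ≤ m (n + m) L`.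
Averaging over `m = j + 1` with weights `p (1 - p) ^ j`, the first moment `S1` is multiplied by `n`
and gives `A ^ n`, while the second moment `S2` gives `C`. -/
lemma associatedWeight_le_of_pow_le (hp0 : 0 < p) (hp1 : p < 1) (hM : ∀ n, 0 < M n)
    (hconv : IsLogConvex M) (hs : Summable fun j : ℕ => (1 - p) ^ j * Real.log (M j)) {ε : ℝ}
    (hε : 0 < ε) (hdec : ∀ n : ℕ, 1 ≤ n → ε ^ n ≤ M n / M (n + 1)) :
    ∃ C A : ℝ, 0 < C ∧ 0 < A ∧ ∀ n, associatedWeight p M n ≤ C * A ^ n * M n := by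
  set L : ℝ := |Real.log ε| with hL
  have hL0 : 0 ≤ L := abs_nonneg _
  have hd1 : ∀ n : ℕ, 1 ≤ n → Real.log (M (n + 1)) - Real.log (M n) ≤ n * L := by
    intro n hn
    have h1 := Real.log_le_log (pow_pos hε n) (hdec n hn)
    rw [Real.log_pow, Real.log_div (hM _).ne' (hM _).ne'] at h1
    have h2 : -L ≤ Real.log ε := neg_abs_le _
    have h3 : (n : ℝ) * -L ≤ n * Real.log ε := by gcongr
    linarith
  -- The decay hypothesis starts at `n = 1`; convexity extends the bound to `n = 0`, at the price of
  -- `n + 1`.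
  have hd : ∀ n : ℕ, Real.log (M (n + 1)) - Real.log (M n) ≤ (n + 1) * L := by
    intro n
    rcases Nat.eq_zero_or_pos n with rfl | hn
    · have h1 := hconv.monotone_sub (Nat.zero_le 1)
      have h2 := hd1 1 le_rfl
      simp only [zero_add, Nat.cast_one, CharP.cast_eq_zero] at h1 h2 ⊢
      linarith
    · linarith [hd1 n hn]
  have hsum : ∀ n m : ℕ, Real.log (M (n + m)) - Real.log (M n) ≤ m * (n + m) * L := by
    intro n m
    induction m with
    | zero => simp
    | succ m ih =>
      have h1 := hd (n + m)
      push_cast at h1 ⊢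
      rw [← add_assoc]
      have : 0 ≤ (m : ℝ) * L := by positivity
      linarith
  have hq0 : 0 < 1 - p := by linarith
  have hnorm : ‖(1 - p : ℝ)‖ < 1 := by
    rw [Real.norm_of_nonneg hq0.le]
    linarith
  have hS : ∀ k : ℕ, Summable fun j : ℕ => p * (1 - p) ^ j * ((j + 1 : ℕ) : ℝ) ^ k := by
    intro k
    have h0 : Summable fun j : ℕ => (j : ℝ) ^ k * (1 - p) ^ j :=
      summable_pow_mul_geometric_of_norm_lt_one k hnorm
    have h1 : Summable fun j : ℕ => ((j + 1 : ℕ) : ℝ) ^ k * (1 - p) ^ (j + 1) :=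
      (summable_nat_add_iff (f := fun j : ℕ => (j : ℝ) ^ k * (1 - p) ^ j) 1).2 h0
    refine (h1.mul_left (p * (1 - p)⁻¹)).congr fun j => ?_
    rw [pow_succ]
    field_simp
  obtain ⟨S1, hS1⟩ := hS 1
  obtain ⟨S2, hS2⟩ := hS 2
  refine ⟨Real.exp (L * S2), Real.exp (L * S1), Real.exp_pos _, Real.exp_pos _, fun n => ?_⟩
  rw [associatedWeight_eq_exp hp1 hM hs, ← Real.exp_nat_mul]
  nth_rewrite 1 [← Real.exp_log (hM n)]
  rw [← Real.exp_add, ← Real.exp_add, Real.exp_le_exp]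
  have hbound : HasSum (fun j : ℕ => p * (1 - p) ^ j * Real.log (M n)
      + (n * L) * (p * (1 - p) ^ j * ((j + 1 : ℕ) : ℝ) ^ 1)
      + L * (p * (1 - p) ^ j * ((j + 1 : ℕ) : ℝ) ^ 2))
      (Real.log (M n) + (n * L) * S1 + L * S2) :=
    ((tsum_mul_geometric hp0 hp1 _).add (hS1.mul_left _)).add
      (hS2.mul_left _)
  have h := (summable_associatedWeight hp1 hs n).tsum_le_tsum (fun j => ?_) hbound.summable
  · rw [hbound.tsum_eq] at h
    linarith
  · have h1 := hsum n (j + 1)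
    have h2 : 0 ≤ p * (1 - p) ^ j := by positivity
    have h3 : Real.log (M (n + (j + 1))) ≤ Real.log (M n)
        + ((j + 1 : ℕ) : ℝ) * (n + ((j + 1 : ℕ) : ℝ)) * L := by linarith
    refine (mul_le_mul_of_nonneg_left h3 h2).trans (le_of_eq ?_)
    ring

end LogConvex

/-! ### Necessity in (ii): compactly supported functions and summable ratios. -/

section Necessity

variable {𝕜 : Type*} [RCLike 𝕜]

lemma carlemanClass_subset {N M : ℕ → ℝ} {C A : ℝ} (hC : 0 < C) (hA : 0 < A)
    (h : ∀ n, N n ≤ C * A ^ n * M n) : carlemanClass 𝕜 N ⊆ carlemanClass 𝕜 M := by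
  rintro f ⟨hf, C', A', hC', hA', hb⟩
  refine ⟨hf, C' * C, A' * A, by positivity, by positivity, fun k => (hb k).trans ?_⟩
  refine ENNReal.ofReal_le_ofReal ?_
  refine (mul_le_mul_of_nonneg_left (h k) (by positivity)).trans (le_of_eq ?_)
  rw [mul_pow]
  ring

lemma carlemanClass_norm_le {M : ℕ → ℝ} (hM : ∀ n, 0 < M n) {f : ℝ → 𝕜}
    (hf : f ∈ carlemanClass 𝕜 M) : ∃ C A : ℝ, 0 < C ∧ 0 < A ∧
      ∀ k x, ‖iteratedDeriv k f x‖ ≤ C * A ^ k * M k := by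
  obtain ⟨hs, C, A, hC, hA, hb⟩ := hf
  refine ⟨C, A, hC, hA, fun k => norm_le_of_eLpNorm_top_le
    (continuous_iteratedDeriv_of_smooth hs k) (mul_nonneg (by positivity) (hM k).le) (hb k)⟩

lemma carlemanClass_sub {M : ℕ → ℝ} (hM : ∀ n, 0 < M n) {f g : ℝ → 𝕜}
    (hf : f ∈ carlemanClass 𝕜 M) (hg : g ∈ carlemanClass 𝕜 M) : f - g ∈ carlemanClass 𝕜 M := by
  obtain ⟨C, A, hC, hA, hfb⟩ := carlemanClass_norm_le hM hf
  obtain ⟨C', A', hC', hA', hgb⟩ := carlemanClass_norm_le hM hg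
  refine ⟨hf.1.sub hg.1, C + C', max A A', by positivity, by positivity, fun k => ?_⟩
  rw [iteratedDeriv_sub_of_smooth hf.1 hg.1]
  refine eLpNorm_top_le_of_norm_le fun x => (norm_sub_le _ _).trans ?_
  refine (add_le_add (hfb k x) (hgb k x)).trans ?_
  have := (hM k).le
  have h1 : C * A ^ k * M k ≤ C * max A A' ^ k * M k := by
    gcongr
    exact le_max_left _ _
  have h2 : C' * A' ^ k * M k ≤ C' * max A A' ^ k * M k := by
    gcongr
    exact le_max_right _ _
  linarith

/-- Cutting off a smooth function to the left of a point where it is flat. -/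
lemma hasDerivAt_cutoff {f : ℝ → 𝕜} (hf : ContDiff ℝ ∞ f) {a : ℝ}
    (ha : ∀ n, iteratedDeriv n f a = 0) (n : ℕ) (x : ℝ) :
    HasDerivAt (fun x => if a < x then iteratedDeriv n f x else 0)
      (if a < x then iteratedDeriv (n + 1) f x else 0) x := by
  rcases lt_trichotomy a x with h | h | h
  · rw [if_pos h]
    refine (hasDerivAt_iteratedDeriv hf n x).congr_of_eventuallyEq ?_
    filter_upwards [Ioi_mem_nhds h] with y hy
    exact if_pos hy
  · subst h
    have h1 := hasDerivAt_iteratedDeriv hf n a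
    rw [ha (n + 1)] at h1
    simp only [lt_irrefl, if_false]
    rw [hasDerivAt_iff_isLittleO] at h1 ⊢
    -- At `a` the cutoff is dominated by the original function, whose derivative vanishes there.
    refine (Asymptotics.isBigO_of_le _ fun y => ?_).trans_isLittleO h1
    simp only [lt_irrefl, if_false, smul_zero, sub_zero, ha n]
    split_ifs
    · exact le_rfl
    · simp
  · rw [if_neg h.not_gt]
    refine (hasDerivAt_const x (0 : 𝕜)).congr_of_eventuallyEq ?_
    filter_upwards [Iio_mem_nhds h] with y hy
    rw [if_neg (not_lt.2 (le_of_lt hy))]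

/-- From a function that is flat at `a` and nonzero at some `x₀ > a` one obtains, by cutting off
and reflecting, a compactly supported function of the same class. -/
lemma exists_compact_of_flat {M : ℕ → ℝ} (hM : ∀ n, 0 < M n) (hconv : IsLogConvex M) {f : ℝ → 𝕜}
    (hf : f ∈ carlemanClass 𝕜 M) {a x₀ : ℝ} (ha : ∀ n, iteratedDeriv n f a = 0) (hx : a < x₀)
    (hfx : f x₀ ≠ 0) : ∃ h : ℝ → 𝕜, ContDiff ℝ ∞ h ∧ h x₀ ≠ 0 ∧
      (∃ C A : ℝ, 0 < C ∧ 0 < A ∧ ∀ n x, ‖iteratedDeriv n h x‖ ≤ C * A ^ n * M n) ∧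
      ∀ n, ∀ x ∉ Set.Icc a (2 * x₀ - a), iteratedDeriv n h x = 0 := by
  obtain ⟨C, A, hC, hA, hb⟩ := carlemanClass_norm_le hM hf
  obtain ⟨hgs, hgd⟩ := contDiff_of_hasDerivAt_succ (hasDerivAt_cutoff hf.1 ha)
  set g : ℝ → 𝕜 := fun x => if a < x then iteratedDeriv 0 f x else 0 with hg
  have hgb : ∀ n x, ‖iteratedDeriv n g x‖ ≤ C * A ^ n * M n := by
    intro n x
    rw [hgd n]
    dsimp only
    split_ifs
    · exact hb n x
    · rw [norm_zero]
      exact mul_nonneg (by positivity) (hM n).le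
  have hrs : ContDiff ℝ ∞ (fun x => g (2 * x₀ - x)) := hgs.comp (contDiff_const.sub contDiff_id)
  have hrb : ∀ n x, ‖iteratedDeriv n (fun x => g (2 * x₀ - x)) x‖ ≤ C * A ^ n * M n := by
    intro n x
    rw [iteratedDeriv_comp_const_sub]
    dsimp only
    rw [norm_smul, norm_pow, norm_neg, norm_one, one_pow, one_mul]
    exact hgb n _
  -- In Leibniz' formula `M_i M_{n-i} ≤ M_0 M_n` by log-convexity, and the binomial coefficients sum
  -- to `2 ^ n`.
  refine ⟨g * fun x => g (2 * x₀ - x), hgs.mul hrs, ?_, ⟨C * C * M 0, 2 * A, ?_, ?_, ?_⟩, ?_⟩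
  · have h1 : g x₀ = f x₀ := by simp [hg, hx]
    simp only [Pi.mul_apply]
    rw [show 2 * x₀ - x₀ = x₀ by ring, h1]
    exact mul_ne_zero hfx hfx
  · have := hM 0
    positivity
  · positivity
  · intro n x
    rw [iteratedDeriv_mul (contDiff_infty.1 hgs n).contDiffAt (contDiff_infty.1 hrs n).contDiffAt]
    refine (norm_sum_le _ _).trans ?_
    have hterm : ∀ i ∈ Finset.range (n + 1), ‖(n.choose i : 𝕜) * iteratedDeriv i g x *
        iteratedDeriv (n - i) (fun x => g (2 * x₀ - x)) x‖
        ≤ n.choose i * (C * C * M 0 * A ^ n * M n) := by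
      intro i hi
      have hin : i + (n - i) = n := Nat.add_sub_cancel' (Nat.lt_succ_iff.1 (Finset.mem_range.1 hi))
      rw [mul_assoc, norm_mul, RCLike.norm_natCast, norm_mul]
      refine mul_le_mul_of_nonneg_left ?_ (Nat.cast_nonneg _)
      refine (mul_le_mul (hgb i x) (hrb (n - i) x) (norm_nonneg _)
        (mul_nonneg (by positivity) (hM i).le)).trans ?_
      have h1 := hconv.mul_le hM i (n - i)
      rw [hin] at h1
      have h2 : A ^ n = A ^ i * A ^ (n - i) := by rw [← pow_add, hin]
      rw [h2]
      calc C * A ^ i * M i * (C * A ^ (n - i) * M (n - i))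
          = C * C * (A ^ i * A ^ (n - i)) * (M i * M (n - i)) := by ring
        _ ≤ C * C * (A ^ i * A ^ (n - i)) * (M 0 * M n) := by gcongr
        _ = _ := by ring
    refine (Finset.sum_le_sum hterm).trans (le_of_eq ?_)
    rw [← Finset.sum_mul, ← Nat.cast_sum, Nat.sum_range_choose]
    push_cast
    ring
  · intro n x hxS
    have hz : (g * fun x => g (2 * x₀ - x)) =ᶠ[𝓝 x] fun _ => 0 := by
      filter_upwards [isClosed_Icc.isOpen_compl.mem_nhds hxS] with y hy
      have hcases : y < a ∨ 2 * x₀ - a < y := by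
        by_contra! h'
        exact hy h'
      simp only [Pi.mul_apply, hg]
      rcases hcases with h' | h'
      · rw [if_neg (not_lt.2 h'.le), zero_mul]
      · rw [if_neg (c := a < 2 * x₀ - y) (by linarith), mul_zero]
    rw [hz.iteratedDeriv_eq]
    simp

/-- The quasinorm tolerates no geometric factor `A ^ n`, so the compactly supported function is
first dilated by `A⁻¹`. It is flat at any point to the left of its support. -/
lemma not_isQuasianalyticLp_of_flat {p : ℝ} (hp0 : 0 < p) (hp1 : p < 1) {M : ℕ → ℝ}
    (hM : ∀ n, 0 < M n) (hconv : IsLogConvex M)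
    (hlim : Tendsto (fun n => (1 - p) ^ n * Real.log (M n)) atTop (𝓝 0)) {f : ℝ → 𝕜}
    (hf : f ∈ carlemanClass 𝕜 M) {a x₀ : ℝ} (ha : ∀ n, iteratedDeriv n f a = 0) (hx : a < x₀)
    (hfx : f x₀ ≠ 0) : ¬ IsQuasianalyticLp (lpCarlemanClass 𝕜 p 0 M) := by
  obtain ⟨h, hh, hx0, ⟨C, A, hC, hA, hb⟩, hsupp⟩ := exists_compact_of_flat hM hconv hf ha hx hfx
  have hk : ∀ n, iteratedDeriv n (fun x => h (A⁻¹ * x))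
      = fun x => A⁻¹ ^ n • iteratedDeriv n h (A⁻¹ * x) :=
    fun n => iteratedDeriv_comp_const_smul (contDiff_infty.1 hh n) _
  have hk0 : ∀ n, ∀ x ∉ Set.Icc (A * a) (A * (2 * x₀ - a)),
      iteratedDeriv n (fun x => h (A⁻¹ * x)) x = 0 := by
    intro n x hxS
    rw [hk]
    dsimp only
    rw [hsupp n _ fun hmem => hxS ?_, smul_zero]
    obtain ⟨h1, h2⟩ := hmem
    rw [inv_mul_eq_div] at h1 h2
    rw [le_div_iff₀ hA] at h1
    rw [div_le_iff₀ hA] at h2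
    exact ⟨by linarith, by linarith⟩
  set V : ℝ := A * (2 * x₀ - a) - A * a with hV
  have hV0 : 0 ≤ V := by
    rw [hV]
    nlinarith
  refine not_isQuasianalyticLp_of_testClass hp1 hM (f := fun x => h (A⁻¹ * x)) (a := A * a - 1)
    (mem_testClass_of_bounds (B := fun n => C * M n) (V := fun _ => V) (c := V ^ p⁻¹ * C)
      hp0 hp1 hM ?_ ?_ ?_ ?_ ?_ ?_ ?_) ?_ ?_
  · exact hh.comp (contDiff_const.mul contDiff_id)
  · exact fun n => mul_pos hC (hM n)
  · exact fun _ => hV0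
  · intro n x
    rw [hk]
    dsimp only
    rw [norm_smul, norm_pow, Real.norm_of_nonneg (inv_pos.2 hA).le]
    refine (mul_le_mul_of_nonneg_left (hb n _) (by positivity)).trans (le_of_eq ?_)
    rw [inv_pow]
    field_simp
  · exact fun n => ⟨Set.Icc (A * a) (A * (2 * x₀ - a)), measurableSet_Icc, by
      rw [Real.volume_Icc], hk0 n⟩
  · exact fun n => le_of_eq (by ring)
  · have h1 : Tendsto (fun n : ℕ => (1 - p) ^ n * Real.log C) atTop (𝓝 (0 * Real.log C)) :=
      (tendsto_pow_atTop_nhds_zero_of_lt_one (by linarith) (by linarith)).mul_const _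
    have h2 := h1.add hlim
    rw [zero_mul, zero_add] at h2
    refine h2.congr fun n => ?_
    rw [Real.log_mul hC.ne' (hM n).ne', mul_add]
  · intro h0
    have h1 := congrFun h0 (A * x₀)
    simp only [Pi.zero_apply, inv_mul_cancel_left₀ hA.ne'] at h1
    exact hx0 h1
  · intro n
    refine hk0 n _ fun hmem => ?_
    linarith [hmem.1]

/-- Non-quasianalyticity of the classical class of `M` passes to the `L^p`-class. -/
theorem isQuasianalytic_of_isQuasianalyticLp {p : ℝ} (hp0 : 0 < p) (hp1 : p < 1) {M : ℕ → ℝ}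
    (hM : ∀ n, 0 < M n) (hconv : IsLogConvex M)
    (hlim : Tendsto (fun n => (1 - p) ^ n * Real.log (M n)) atTop (𝓝 0))
    (hq : IsQuasianalyticLp (lpCarlemanClass 𝕜 p 0 M)) :
    IsQuasianalytic (carlemanClass 𝕜 M) := by
  intro f hf g hg a hfg
  by_contra hne
  have hd := carlemanClass_sub hM hf hg
  have hd0 : ∀ n, iteratedDeriv n (f - g) a = 0 := fun n => by
    rw [iteratedDeriv_sub_of_smooth hf.1 hg.1, Pi.sub_apply, hfg, sub_self]
  obtain ⟨x₀, hx₀⟩ := Function.ne_iff.1 hne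
  have hx₁ : (f - g) x₀ ≠ 0 := sub_ne_zero.2 hx₀
  rcases lt_trichotomy a x₀ with h | h | h
  · exact not_isQuasianalyticLp_of_flat hp0 hp1 hM hconv hlim hd hd0 h hx₁ hq
  · exact hx₁ (by simpa [← h] using hd0 0)
  · have hr := carlemanClass_comp_mul hM hd (neg_ne_zero.2 one_ne_zero)
    refine not_isQuasianalyticLp_of_flat hp0 hp1 hM hconv hlim hr (a := -a) (x₀ := -x₀)
      (fun n => ?_) (neg_lt_neg h) (by simpa using hx₁) hq
    rw [iteratedDeriv_comp_const_smul (contDiff_infty.1 hd.1 n)]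
    simp [hd0 n]

/-- The product of the ratios `M_{n-1} / M_n` telescopes to `M_0 / M_n`, so boxes of these widths
yield derivatives of size `M_n`. The factor `2 exp l` in the widths offsets the powers of two from
differencing and from the doubling of the carrier. -/
theorem not_isQuasianalyticLp_of_summable_ratio {p : ℝ} (hp0 : 0 < p) (hp1 : p < 1) {M : ℕ → ℝ}
    (hM : ∀ n, 0 < M n) (hlim : Tendsto (fun n => (1 - p) ^ n * Real.log (M n)) atTop (𝓝 0))
    (hs : Summable fun n : ℕ => M (n + 1) / M (n + 2)) :
    ¬ IsQuasianalyticLp (lpCarlemanClass 𝕜 p 0 M) := by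
  set l : ℝ := Real.log 2 / p with hl
  set a : ℕ → ℝ := fun n => 2 * Real.exp l * (if n = 0 then 1 else M (n - 1) / M n) with ha
  have ha0 : ∀ n, 0 < a n := fun n => by
    rw [ha]
    dsimp only
    split_ifs
    · positivity
    · have := hM n
      have := hM (n - 1)
      positivity
  have hsa : Summable a := by
    refine Summable.mul_left _ ?_
    rw [← summable_nat_add_iff 2]
    exact hs.congr fun n => by simp
  have hM0 := hM 0
  refine not_isQuasianalyticLp_of_summable (a := a) (t := fun _ => ∑' k, a k)
    (B := fun n => M n / M 0 * Real.exp (-((n + 1) * l))) (θ' := 0)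
    (c := (∑' k, a k) ^ p⁻¹ * Real.exp (-l) / M 0) hp0 hp1 le_rfl hM ha0 hsa ?_ ?_ ?_ ?_
  · intro n
    have hprod : ∏ i ∈ Finset.range (n + 1), (if i = 0 then 1 else M (i - 1) / M i)
        = M 0 / M n := by
      induction n with
      | zero => simp [hM0.ne']
      | succ n ih =>
        rw [Finset.prod_range_succ, ih]
        simp only [Nat.add_eq_zero_iff, one_ne_zero, and_false, if_false, Nat.add_sub_cancel]
        have := (hM n).ne'
        have := (hM (n + 1)).ne'
        field_simp
    rw [ha, Finset.prod_mul_distrib, hprod, Finset.prod_const, Finset.card_range, mul_pow,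
      ← Real.exp_nat_mul, Real.exp_neg]
    have := (hM n).ne'
    push_cast
    field_simp
  · intro n
    have h := hsa.sum_add_tsum_nat_add n
    have h1 : 0 ≤ ∑ i ∈ Finset.range n, a i := Finset.sum_nonneg fun i _ => (ha0 i).le
    simp only [add_comm n]
    linarith
  · intro n
    have hT : 0 ≤ ∑' k, a k := tsum_nonneg fun k => (ha0 k).le
    have h2 : ((2 : ℝ) ^ n) ^ p⁻¹ = Real.exp (n * l) := by
      rw [← Real.rpow_natCast, ← Real.rpow_mul two_pos.le, Real.rpow_def_of_pos two_pos, hl]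
      congr 1
      ring
    rw [Real.mul_rpow (by positivity) hT, h2]
    have h3 : Real.exp (n * l) * Real.exp (-((n + 1) * l)) = Real.exp (-l) := by
      rw [← Real.exp_add]
      congr 1
      ring
    refine le_of_eq ?_
    rw [← h3]
    ring
  · have hq0 : (0 : ℝ) ≤ 1 - p := by linarith
    have h1 := tendsto_self_mul_const_pow_of_lt_one hq0 (show 1 - p < 1 by linarith)
    have h2 := tendsto_pow_atTop_nhds_zero_of_lt_one hq0 (show 1 - p < 1 by linarith)
    have h3 := (hlim.sub (h2.mul_const (Real.log (M 0) + l))).sub (h1.mul_const l)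
    simp only [zero_mul, sub_zero] at h3
    refine h3.congr fun n => ?_
    rw [Real.log_mul (div_pos (hM n) hM0).ne' (Real.exp_pos _).ne', Real.log_exp,
      Real.log_div (hM n).ne' hM0.ne']
    ring

end Necessity

end LpCarleman

theorem mainTheorem3 {𝕜 : Type*} [RCLike 𝕜] (p : ℝ) (hp0 : 0 < p) (hp1 : p < 1)
    (M : ℕ → ℝ) (hpos : ∀ n, 0 < M n) (hconv : LpCarleman.IsLogConvex M)
    (hbdd : ∃ c : ℝ, 0 < c ∧ ∀ n, c ≤ M n)
    (hκ : LpCarleman.pCharacteristic p M < ⊤) :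
    (∀ θ : ℝ, 0 < θ →
      ¬ LpCarleman.IsQuasianalyticLp (LpCarleman.lpCarlemanClass 𝕜 p θ M)) ∧
    (LpCarleman.IsDecayRegular M →
      (LpCarleman.IsQuasianalyticLp (LpCarleman.lpCarlemanClass 𝕜 p 0 M) ↔
        LpCarleman.IsQuasianalytic
          (LpCarleman.carlemanClass 𝕜 (LpCarleman.associatedWeight p M)))) := by
  have hs := LpCarleman.summable_pow_mul_log hp0 hp1 hbdd hκ
  have hlim := LpCarleman.tendsto_pow_mul_log hp0 hp1 hbdd hκ
  refine ⟨fun θ hθ => LpCarleman.not_isQuasianalyticLp_of_pos hp0 hp1 hθ hpos hbdd, fun hreg =>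
    ⟨fun hq => ?_, LpCarleman.isQuasianalyticLp_of_isQuasianalytic hp0 hp1 hpos hbdd hs⟩⟩
  -- In the first case quasianalyticity passes from the `L^p` class to `C_M` and then to its
  -- subclass `C_N`; in the second the `L^p` class is never quasianalytic.
  rcases hreg with ⟨ε, hε, hdec⟩ | hsum
  · obtain ⟨C, A, hC, hA, hle⟩ :=
      LpCarleman.associatedWeight_le_of_pow_le hp0 hp1 hpos hconv hs hε hdec
    have hsub := LpCarleman.carlemanClass_subset (𝕜 := 𝕜) hC hA hle
    have hM := LpCarleman.isQuasianalytic_of_isQuasianalyticLp hp0 hp1 hpos hconv hlim hq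
    exact fun f hf g hg => hM f (hsub hf) g (hsub hg)
  · exact absurd hq
      (LpCarleman.not_isQuasianalyticLp_of_summable_ratio hp0 hp1 hpos hlim hsum)
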